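/- Let $N\ge 1$, $T>0$, and let $\{\Omega_t\}_{t\in[0,T]}$ be nonempty bounded open subsets of $\mathbb R^N$ with Lipschitz boundary, with $\Omega_s\subseteq\Omega_t$ for $0\le s\le t\le T$, and with $\Omega_0$ convex or of class $C^2$. Put $\mathcal O=\bigcup_{t\in(0,T)}\{t\}\times\Omega_t$ and $\Gamma=\bigcup_{t\in(0,T)}\{t\}\times\partial\Omega_t$. Assume that there are maps $\Phi\colon[0,T]\times\overline{\Omega}_0\to\mathbb R^N$ and $\Psi\colon\overline{\mathcal O}\to\overline{\Omega}_0$ of class $C^{2,1}$ such that $\Phi(t,\Omega_0)=\Omega_t$ and $\Psi(t,\Omega_t)=\Omega_0$ for all $t\in[0,T]$, $\Phi(t,\Psi(t,x))=x$ on $\overline{\mathcal O}$, $\Psi(t,\Phi(t,y))=y$ and $|\dot\Phi(t,y)|<1$ on $[0,T]\times\overline\Omega_0$, and $\Phi(0,y)=y$ on $\overline\Omega_0$. Let $f\in H^1(\mathcal O)$, $u_0\in H^2(\Omega_0)\cap H^1_0(\Omega_0)$ and $u_1+\dot\Phi(0,\cdot)\cdot\nabla u_0\in H^1_0(\Omega_0)$.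 Let $u$ be the (unique) weak solution of $$\ddot u-\Delta u=f\ \text{ in }\mathcal O,\qquad u=0\ \text{ on }\Gamma,\qquad u(0)=u_0,\quad \dot u(0)=u_1\ \text{ in }\Omega_0,$$ that is: with $u$ extended by $0$ outside $\mathcal O$, (i) $u\in L^2(0,T;H^1_0(\Omega_t))$ and $\dot u\in L^2(0,T;L^2(\Omega_t))$; (ii) $u\in C^0([0,T];L^2(\Omega_0))$, $\dot u\in C^0([0,\delta];H^{-1}(\Omega'))$ whenever $0<\delta<T$ and $\Omega'$ is open with $\Omega'\subseteq\Omega_t$ for all $t\in[0,\delta]$, and in these spaces $u(0)=u_0$, $\dot u(0)=u_1$; (iii) $$-\int_{\mathcal O}\dot u\,\dot\eta\,dx\,dt+\int_{\mathcal O}\nabla u\cdot\nabla\eta\,dx\,dt=\int_{\mathcal O}f\,\eta\,dx\,dt$$ for all $\eta\in L^2(0,T;H^1_0(\Omega_t))$ with $\dot\eta\in L^2(0,T;L^2(\Omega_t))$ and $\eta(0)=\eta(T)=0$. Let $\nu_{\Omega_t}$ be the outward unit normal to $\Omega_t$, let $\omega(t,x)=\dot\Phi(t,\Psi(t,x))\cdot\nu_{\Omega_t}(x)$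 be the scalar normal velocity of $\partial\Omega_t$, and let $\dot u(t,x)$ and $\frac{\partial u}{\partial\nu_{\Omega_t}}(t,x)=\nabla u(t,x)\cdot\nu_{\Omega_t}(x)$, for $x\in\partial\Omega_t$, be given by the trace on $\Gamma$ of the space-time gradient $(\dot u,\nabla u)$. For $\alpha\in[0,1)$ define the dynamic energy release rate density $$G_\alpha(t,x)=\frac12(1-\alpha^2)\Big(\frac{\partial u}{\partial\nu_{\Omega_t}}(t,x)\Big)^2 .$$ Let $\kappa\colon\mathbb R^N\to(0,\infty)$ be continuous. Then the following conditions are equivalent, where each is required for a.e. $t\in[0,T]$ and for $\mathcal H^{N-1}$-a.e. $x\in\partial\Omega_t$: 1. (local maximum dissipation principle) $\omega(t,x)=\max\{\alpha\in[0,1):\ \alpha\,\kappa(x)=\alpha\,G_\alpha(t,x)\}$; 2. (local dynamic Griffith criterion) $0\le\omega(t,x)<1$, $\ G_{\omega(t,x)}(t,x)\le\kappa(x)$ and $\ \omega(t,x)\,[G_{\omega(t,x)}(t,x)-\kappa(x)]=0$; 3. $\omega(t,x)=\sqrt{1-2\kappa(x)\big(\frac{\partial u}{\partial\nu_{\Omega_t}}(t,x)\big)^{-2}}$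 if $\big(\frac{\partial u}{\partial\nu_{\Omega_t}}(t,x)\big)^2>2\kappa(x)$, and $\omega(t,x)=0$ otherwise; 4. $\displaystyle\omega(t,x)=\max\left\{\frac{\big[\frac{\partial u}{\partial\nu_{\Omega_t}}(t,x)-\dot u(t,x)\big]^2-2\kappa(x)}{\big[\frac{\partial u}{\partial\nu_{\Omega_t}}(t,x)-\dot u(t,x)\big]^2+2\kappa(x)},\ 0\right\}$. -/

import Mathlib

open MeasureTheory Set Filter Topology
open scoped ENNReal NNReal ContDiff RealInnerProductSpace

noncomputable section

/-- The Euclidean space `ℝ^N`. -/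
abbrev Space (N : ℕ) := EuclideanSpace ℝ (Fin N)

/-! ### Lebesgue and Sobolev spaces on open sets -/

section Sobolev

variable {W : Type*} [NormedAddCommGroup W] [NormedSpace ℝ W] [MeasureSpace W]

/-- `C_c^∞(U)`. -/
def testSpace (U : Set W) : Submodule ℝ (W → ℝ) where
  carrier := {φ | ContDiff ℝ ∞ φ ∧ HasCompactSupport φ ∧ tsupport φ ⊆ U}
  zero_mem' := ⟨contDiff_const, HasCompactSupport.zero, by
    have h : tsupport (0 : W → ℝ) = ∅ := by rw [tsupport_eq_empty_iff]
    rw [h]; exact empty_subset _⟩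
  add_mem' := fun {φ ψ} hφ hψ =>
    ⟨hφ.1.add hψ.1, hφ.2.1.add hψ.2.1,
      (tsupport_add φ ψ).trans (union_subset hφ.2.2 hψ.2.2)⟩
  smul_mem' := fun c φ hφ =>
    ⟨contDiff_const.smul hφ.1, hφ.2.1.smul_left (f := fun _ => c),
      (tsupport_smul_subset_right (fun _ => c) φ).trans hφ.2.2⟩

/-- `w ∈ L²(U)`. -/
def MemL2 {F : Type*} [NormedAddCommGroup F] (U : Set W) (w : W → F) : Prop :=
  MemLp w 2 (volume.restrict U)

/-- `g` is the weak derivative of `w` in the direction `v` in the open set `U`. -/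
def IsWeakDeriv (U : Set W) (v : W) (w g : W → ℝ) : Prop :=
  ∀ φ ∈ testSpace U, ∫ z in U, w z * fderiv ℝ φ z v = - ∫ z in U, g z * φ z

/-- `w ∈ H¹(U)`. -/
def MemH1 (U : Set W) (w : W → ℝ) : Prop :=
  MemL2 U w ∧ ∀ v, ∃ g, MemL2 U g ∧ IsWeakDeriv U v w g

/-- `w ∈ H²(U)`. -/
def MemH2 (U : Set W) (w : W → ℝ) : Prop :=
  MemL2 U w ∧ ∀ v, ∃ g, MemH1 U g ∧ IsWeakDeriv U v w g

/-- `w ∈ H¹₀(U)`, the closure of `C_c^∞(U)` in the `H¹` norm. -/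
def MemH10 (U : Set W) (w : W → ℝ) : Prop :=
  MemL2 U w ∧ ∃ φ : ℕ → W → ℝ, (∀ n, φ n ∈ testSpace U) ∧
    Tendsto (fun n => eLpNorm (fun z => φ n z - w z) 2 (volume.restrict U)) atTop (𝓝 0) ∧
    ∀ v, ∃ g, MemL2 U g ∧
      Tendsto (fun n => eLpNorm (fun z => fderiv ℝ (φ n) z v - g z) 2 (volume.restrict U))
        atTop (𝓝 0)

/-- The `H¹` norm of a test function. -/
def h1Norm (φ : W → ℝ) : ℝ :=
  √((∫ z, φ z ^ 2) + ∫ z, ‖fderiv ℝ φ z‖ ^ 2)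

/-- The curve `V : [0,δ] → H⁻¹(U)` takes values in `H⁻¹(U)`, the space of the linear functionals
on `C_c^∞(U)` that are bounded for the `H¹` norm (equivalently the dual of `H¹₀(U)`), and it is
continuous for the norm of that space. -/
def IsContinuousHMinusOne (δ : ℝ) (U : Set W) (V : ℝ → testSpace U →ₗ[ℝ] ℝ) : Prop :=
  (∀ t ∈ Icc 0 δ, ∃ C : ℝ, ∀ φ : testSpace U, |V t φ| ≤ C * h1Norm (φ : W → ℝ)) ∧
  ∀ t ∈ Icc 0 δ, ∀ ε > 0, ∀ᶠ s in 𝓝[Icc 0 δ] t,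
    ∀ φ : testSpace U, |V s φ - V t φ| ≤ ε * h1Norm (φ : W → ℝ)

/-- `w` has the boundary value (trace) `a` at the point `z` of the closure of `U`: the averages
of `|w - a|` over `U ∩ B_r(z)` tend to `0`. For an open set with Lipschitz boundary and
`w ∈ H¹(U)` this holds at almost every boundary point `z`, with `a` the value at `z` of the usual
`L²(∂U)` trace of `w`. -/
def HasTraceAt {F : Type*} [NormedAddCommGroup F] (U : Set W) (w : W → F) (z : W) (a : F) : Prop :=
  Tendsto (fun r : ℝ => ⨍⁻ y in U ∩ Metric.ball z r, ‖w y - a‖ₑ ∂volume) (𝓝[>] 0) (𝓝 0)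

open Classical in
/-- The trace of `w` at the boundary point `z`. -/
def traceAt {F : Type*} [NormedAddCommGroup F] (U : Set W) (w : W → F) (z : W) : F :=
  if h : ∃ a, HasTraceAt U w z a then h.choose else 0

/-- `f` is of class `C^{2,1}` on the (closed) set `S`. -/
def IsC21On {F : Type*} [NormedAddCommGroup F] [NormedSpace ℝ F] (f : W → F) (S : Set W) : Prop :=
  ContDiffOn ℝ 2 f S ∧ ∃ K : ℝ≥0, LipschitzOnWith K (iteratedFDerivWithin ℝ 2 f S) S

end Sobolev

/-! ### Domains in `ℝ^N` -/

section Domains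

variable {N : ℕ}

/-- Near `x`, the set `U` is the strict subgraph, in the direction of the unit vector `e`, of
the function `γ` on the hyperplane orthogonal to `e`. -/
def IsSubgraphNear (U : Set (Space N)) (x e : Space N) (γ : Space N → ℝ) : Prop :=
  ‖e‖ = 1 ∧ ∀ᶠ y in 𝓝 x, (y ∈ U ↔ ⟪y, e⟫ < γ (y - ⟪y, e⟫ • e))

/-- `U` has Lipschitz boundary. -/
def HasLipschitzBoundary (U : Set (Space N)) : Prop :=
  ∀ x ∈ frontier U, ∃ (e : Space N) (γ : Space N → ℝ) (K : ℝ≥0),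
    LipschitzWith K γ ∧ IsSubgraphNear U x e γ

/-- `U` has boundary of class `C²`. -/
def HasC2Boundary (U : Set (Space N)) : Prop :=
  ∀ x ∈ frontier U, ∃ (e : Space N) (γ : Space N → ℝ),
    ContDiff ℝ 2 γ ∧ IsSubgraphNear U x e γ

/-- `ν` is the outward unit normal to `U` at the boundary point `x`: near `x`, up to cones
around the tangent hyperplane of arbitrarily small opening, `U` is the half space
`(y - x) · ν < 0`. -/
def IsOuterNormal (U : Set (Space N)) (x ν : Space N) : Prop :=
  ‖ν‖ = 1 ∧ ∀ ε > 0, ∀ᶠ y in 𝓝 x,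
    (⟪y - x, ν⟫ < -(ε * ‖y - x‖) → y ∈ U) ∧ (ε * ‖y - x‖ < ⟪y - x, ν⟫ → y ∉ U)

open Classical in
/-- The outward unit normal to `U` at `x`. -/
def outerNormal (U : Set (Space N)) (x : Space N) : Space N :=
  if h : ∃ ν, IsOuterNormal U x ν then h.choose else 0

end Domains

/-! ### Moving domains and the wave equation -/

section Wave

variable {N : ℕ}

/-- The noncylindrical space-time domain `𝒪 = ⋃_{t ∈ (0,T)} {t} × Ω_t`. -/
def spaceTime (T : ℝ) (Ω : ℝ → Set (Space N)) : Set (ℝ × Space N) :=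
  {z | z.1 ∈ Ioo 0 T ∧ z.2 ∈ Ω z.1}

/-- The time derivative `∂_t Φ(t,y)` of a map defined for `t ∈ [0,T]` (one-sided at the
endpoints). -/
def timeDeriv (T : ℝ) (Φ : ℝ × Space N → Space N) (t : ℝ) (y : Space N) : Space N :=
  derivWithin (fun s => Φ (s, y)) (Icc 0 T) t

/-- The maps `Φ : [0,T] × closure Ω_0 → ℝ^N` and `Ψ : closure 𝒪 → closure Ω_0` are families of
mutually inverse diffeomorphisms of class `C^{2,1}` between `Ω_0` and `Ω_t`, starting from the
identity, and the speed of `Φ` is less than `1`. -/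
structure IsMovingDiffeo (T : ℝ) (Ω : ℝ → Set (Space N)) (Φ Ψ : ℝ × Space N → Space N) :
    Prop where
  image_Φ : ∀ t ∈ Icc 0 T, (fun y => Φ (t, y)) '' Ω 0 = Ω t
  image_Ψ : ∀ t ∈ Icc 0 T, (fun x => Ψ (t, x)) '' Ω t = Ω 0
  right_inv : ∀ t x, (t, x) ∈ closure (spaceTime T Ω) → Φ (t, Ψ (t, x)) = x
  left_inv : ∀ t ∈ Icc 0 T, ∀ y ∈ closure (Ω 0), Ψ (t, Φ (t, y)) = y
  initial : ∀ y ∈ closure (Ω 0), Φ (0, y) = y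
  smooth_Φ : IsC21On Φ (Icc 0 T ×ˢ closure (Ω 0))
  smooth_Ψ : IsC21On Ψ (closure (spaceTime T Ω))
  speed_lt : ∀ t ∈ Icc 0 T, ∀ y ∈ closure (Ω 0), ‖timeDeriv T Φ t y‖ < 1

/-- `u ∈ L²(0,T;H¹₀(Ω_t))` and `∂_t u ∈ L²(0,T;L²(Ω_t))`, where `ut` and `gu` are (representatives
of) the weak time derivative and the weak spatial gradient of `u` in `𝒪`. -/
structure MemEnergySpace (T : ℝ) (Ω : ℝ → Set (Space N)) (u ut : ℝ × Space N → ℝ)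
    (gu : ℝ × Space N → Space N) : Prop where
  memL2 : MemL2 (spaceTime T Ω) u
  memL2_time : MemL2 (spaceTime T Ω) ut
  memL2_grad : MemL2 (spaceTime T Ω) gu
  weakDeriv_time : IsWeakDeriv (spaceTime T Ω) (1, 0) u ut
  weakDeriv_space : ∀ v : Space N, IsWeakDeriv (spaceTime T Ω) (0, v) u (fun z => ⟪gu z, v⟫)
  zero_boundary : ∀ᵐ t ∂(volume.restrict (Ioo 0 T)), MemH10 (Ω t) (fun x => u (t, x))

/-- `U : [0,T] → L²(D)` is a continuous representative of the curve `t ↦ u(t)`, where `u` is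
extended by `0` outside `𝒪`. -/
def IsContinuousRepr (T : ℝ) (Ω : ℝ → Set (Space N)) (D : Set (Space N))
    (u : ℝ × Space N → ℝ) (U : ℝ → Lp ℝ 2 (volume.restrict D)) : Prop :=
  ContinuousOn U (Icc 0 T) ∧
  ∀ᵐ t ∂(volume.restrict (Ioo 0 T)),
    U t =ᵐ[volume.restrict D] (Ω t).indicator (fun x => u (t, x))

/-- `u` is a weak solution of `∂_t² u - Δu = f` in `𝒪`, `u = 0` on the lateral boundary,
`u(0) = u₀`, `∂_t u(0) = u₁` in `Ω_0`; `ut` and `gu` are its weak time derivative and its weak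
spatial gradient. -/
structure IsWeakSolution (T : ℝ) (Ω : ℝ → Set (Space N)) (f : ℝ × Space N → ℝ)
    (u₀ u₁ : Space N → ℝ) (u ut : ℝ × Space N → ℝ) (gu : ℝ × Space N → Space N) : Prop where
  energy : MemEnergySpace T Ω u ut gu
  /- `u ∈ C⁰([0,T];L²(Ω_0))` and `u(0) = u₀`. -/
  initial_position : ∃ U : ℝ → Lp ℝ 2 (volume.restrict (Ω 0)),
    IsContinuousRepr T Ω (Ω 0) u U ∧ U 0 =ᵐ[volume.restrict (Ω 0)] u₀
  /- `∂_t u ∈ C⁰([0,δ];H⁻¹(Ω'))` whenever `Ω' ⊆ Ω_t` for all `t ∈ [0,δ]`, and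
  `∂_t u(0) = u₁`. -/
  initial_velocity : ∀ δ ∈ Ioo 0 T, ∀ Ω' : Set (Space N), IsOpen Ω' →
    (∀ t ∈ Icc 0 δ, Ω' ⊆ Ω t) →
    ∃ V : ℝ → testSpace Ω' →ₗ[ℝ] ℝ, IsContinuousHMinusOne δ Ω' V ∧
      (∀ᵐ t ∂(volume.restrict (Ioo 0 δ)), ∀ φ : testSpace Ω',
        V t φ = ∫ x in Ω', ut (t, x) * (φ : Space N → ℝ) x) ∧
      ∀ φ : testSpace Ω', V 0 φ = ∫ x in Ω', u₁ x * (φ : Space N → ℝ) x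
  /- The weak formulation, with test functions `η` such that `η(0) = η(T) = 0`. -/
  equation : ∀ (η ηt : ℝ × Space N → ℝ) (gη : ℝ × Space N → Space N),
    MemEnergySpace T Ω η ηt gη →
    (∃ H : ℝ → Lp ℝ 2 (volume.restrict (univ : Set (Space N))),
      IsContinuousRepr T Ω univ η H ∧ H 0 = 0 ∧ H T = 0) →
    -(∫ z in spaceTime T Ω, ut z * ηt z) + ∫ z in spaceTime T Ω, ⟪gu z, gη z⟫
      = ∫ z in spaceTime T Ω, f z * η z

/-- The scalar normal velocity `ω(t,x) = ∂_t Φ(t,Ψ(t,x)) · ν_{Ω_t}(x)`. -/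
def normalVelocity (T : ℝ) (Ω : ℝ → Set (Space N)) (Φ Ψ : ℝ × Space N → Space N)
    (t : ℝ) (x : Space N) : ℝ :=
  ⟪timeDeriv T Φ t (Ψ (t, x)), outerNormal (Ω t) x⟫

/-- The boundary value at `(t,x)` of the space-time gradient `(∂_t u, ∇u)` of `u`, i.e. its trace
on the lateral boundary of `𝒪`. The balls of `ℝ × ℝ^N` are the cylinders
`(t - r, t + r) × B_r(x)`, which are comparable to the Euclidean balls. -/
def gradTrace (T : ℝ) (Ω : ℝ → Set (Space N)) (ut : ℝ × Space N → ℝ)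
    (gu : ℝ × Space N → Space N) (t : ℝ) (x : Space N) : ℝ × Space N :=
  traceAt (spaceTime T Ω) (fun z => (ut z, gu z)) (t, x)

/-- The boundary value of `∂_t u` at `x ∈ ∂Ω_t`. -/
def boundaryVelocity (T : ℝ) (Ω : ℝ → Set (Space N)) (ut : ℝ × Space N → ℝ)
    (gu : ℝ × Space N → Space N) (t : ℝ) (x : Space N) : ℝ :=
  (gradTrace T Ω ut gu t x).1

/-- The normal derivative `∂u/∂ν_{Ω_t}` at `x ∈ ∂Ω_t`. -/
def normalDeriv (T : ℝ) (Ω : ℝ → Set (Space N)) (ut : ℝ × Space N → ℝ)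
    (gu : ℝ × Space N → Space N) (t : ℝ) (x : Space N) : ℝ :=
  ⟪(gradTrace T Ω ut gu t x).2, outerNormal (Ω t) x⟫

/-- The dynamic energy release rate density
`G_α(t,x) = (1 - α²)/2 (∂u/∂ν_{Ω_t}(t,x))²` with speed `α ∈ [0,1)`. -/
def releaseRateDensity (T : ℝ) (Ω : ℝ → Set (Space N)) (ut : ℝ × Space N → ℝ)
    (gu : ℝ × Space N → Space N) (α t : ℝ) (x : Space N) : ℝ :=
  1 / 2 * (1 - α ^ 2) * normalDeriv T Ω ut gu t x ^ 2

/-- `P t x` holds for a.e. `t ∈ [0,T]` and `ℋ^{N-1}`-a.e. `x ∈ ∂Ω_t`. -/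
def AEBoundary (T : ℝ) (Ω : ℝ → Set (Space N)) (P : ℝ → Space N → Prop) : Prop :=
  ∀ᵐ t ∂(volume.restrict (Icc 0 T)),
    ∀ᵐ x ∂((Measure.hausdorffMeasure ((N : ℝ) - 1)).restrict (frontier (Ω t))), P t x

/-- The local maximum dissipation principle. -/
def MaximumDissipation (T : ℝ) (Ω : ℝ → Set (Space N)) (Φ Ψ : ℝ × Space N → Space N)
    (ut : ℝ × Space N → ℝ) (gu : ℝ × Space N → Space N) (κ : Space N → ℝ) : Prop :=
  AEBoundary T Ω fun t x =>
    IsGreatest {α | α ∈ Ico (0 : ℝ) 1 ∧ α * κ x = α * releaseRateDensity T Ω ut gu α t x}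
      (normalVelocity T Ω Φ Ψ t x)

/-- The local dynamic Griffith criterion. -/
def GriffithCriterion (T : ℝ) (Ω : ℝ → Set (Space N)) (Φ Ψ : ℝ × Space N → Space N)
    (ut : ℝ × Space N → ℝ) (gu : ℝ × Space N → Space N) (κ : Space N → ℝ) : Prop :=
  AEBoundary T Ω fun t x =>
    let α := normalVelocity T Ω Φ Ψ t x
    let G := releaseRateDensity T Ω ut gu α t x
    (0 ≤ α ∧ α < 1) ∧ G ≤ κ x ∧ α * (G - κ x) = 0

/-- The explicit formula for the normal velocity in terms of `∂u/∂ν`. -/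
def NormalDerivFormula (T : ℝ) (Ω : ℝ → Set (Space N)) (Φ Ψ : ℝ × Space N → Space N)
    (ut : ℝ × Space N → ℝ) (gu : ℝ × Space N → Space N) (κ : Space N → ℝ) : Prop :=
  AEBoundary T Ω fun t x =>
    let p := normalDeriv T Ω ut gu t x
    (2 * κ x < p ^ 2 → normalVelocity T Ω Φ Ψ t x = √(1 - 2 * κ x / p ^ 2)) ∧
    (¬ 2 * κ x < p ^ 2 → normalVelocity T Ω Φ Ψ t x = 0)

/-- The explicit formula for the normal velocity in terms of `∂u/∂ν - ∂_t u`. -/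
def CharacteristicFormula (T : ℝ) (Ω : ℝ → Set (Space N)) (Φ Ψ : ℝ × Space N → Space N)
    (ut : ℝ × Space N → ℝ) (gu : ℝ × Space N → Space N) (κ : Space N → ℝ) : Prop :=
  AEBoundary T Ω fun t x =>
    let s := normalDeriv T Ω ut gu t x - boundaryVelocity T Ω ut gu t x
    normalVelocity T Ω Φ Ψ t x = max ((s ^ 2 - 2 * κ x) / (s ^ 2 + 2 * κ x)) 0

end Wave

end

/-!
At a lateral boundary point `(t, x)` with outer normal `ν` put `ω` for the normal velocity and
`p = ∂_ν u`. Everything rests on two facts, valid almost everywhere on the lateral boundary: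
`0 ≤ ω < 1`, and `∂_t u = -ω p`. Given these, each of the four conditions is equivalent to
`(1 - ω²) p² / 2 ≤ κ` with equality if `ω ≠ 0`, by elementary algebra at the point `(t, x)`
(`isGreatest_dissipation_iff`, `normalDeriv_formula_iff`, `characteristic_formula_iff`).

The outer normal exists at almost every boundary point by Rademacher's theorem
(`HasLipschitzBoundary.ae_exists_isOuterNormal`). There `ω < 1` is the bound on the speed of `Φ`, and
`0 ≤ ω` holds because the domains grow (`IsMovingDiffeo.normalVelocity_nonneg`).

The relation `∂_t u + ω p = 0` says that the derivative of `u` in the direction `(1, ω ν)`, which is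
tangential to the lateral boundary, vanishes because `u` does. It is proved by a blow-up at a point
where the trace of `(∂_t u, ∇u)` exists:

* To first order `𝒪` is at `(t, x)` the half space `(y - x) · ν < ω (s - t)`
  (`IsMovingDiffeo.spaceTime_normal`). Only continuous differentiability of `Φ`,
  continuity of `Ψ` and connectedness of balls are used.
* Since `u(t) ∈ H¹₀(Ω_t)` for almost every `t`, the spatial gradient is integrated by parts without
  boundary terms against test functions that do not vanish on the lateral boundary
  (`MemEnergySpace.integral_mul_fderiv`).
* For the time derivative only test functions supported in `𝒪` are available. These suffice, with
  a test function that is constant in the direction `ν` near the boundary: its `ν`-derivative is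
  supported away from the boundary, so that `∂_t ∂_ν u = ∂_ν ∂_t u` can be tested with it. In the limit of small scales the gradient of `u` becomes constant, and the
  relation between its components drops out (`trace_add_mul_trace_eq_zero`).

At a boundary point without a trace `traceAt` is `0`, and the relation reads `0 = 0`; hence the
equivalence needs no regularity of the weak solution up to the boundary.
-/

/-! ### The pointwise equivalences -/

section Pointwise

variable {κ w p q : ℝ}

theorem isGreatest_dissipation_iff (hκ : 0 < κ) (h0 : 0 ≤ w) (h1 : w < 1) :
    IsGreatest {α | α ∈ Ico (0 : ℝ) 1 ∧ α * κ = α * (1 / 2 * (1 - α ^ 2) * p ^ 2)} w ↔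
      1 / 2 * (1 - w ^ 2) * p ^ 2 ≤ κ ∧ w * (1 / 2 * (1 - w ^ 2) * p ^ 2 - κ) = 0 := by
  constructor
  · rintro ⟨⟨-, hw⟩, hub⟩
    refine ⟨?_, by linarith⟩
    by_contra! hlt
    -- If the release rate exceeds the toughness, the set contains a larger speed.
    have hp : 0 < p ^ 2 := by
      by_contra! h
      have : p ^ 2 = 0 := le_antisymm h (sq_nonneg p)
      rw [this] at hlt; linarith
    have hw0 : w = 0 := by
      rcases mul_eq_zero.1 (show w * (κ - 1 / 2 * (1 - w ^ 2) * p ^ 2) = 0 by linarith) with h | h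
      · exact h
      · linarith
    subst hw0
    have hlt' : 2 * κ / p ^ 2 < 1 := by rw [div_lt_one hp]; linarith
    have hpos : 0 < 2 * κ / p ^ 2 := by positivity
    have hdiv : 2 * κ / p ^ 2 * p ^ 2 = 2 * κ := div_mul_cancel₀ _ hp.ne'
    have hsq : √(1 - 2 * κ / p ^ 2) ^ 2 = 1 - 2 * κ / p ^ 2 := Real.sq_sqrt (by linarith)
    have hspos : 0 < √(1 - 2 * κ / p ^ 2) := Real.sqrt_pos.2 (by linarith)
    have hmem := hub (a := √(1 - 2 * κ / p ^ 2)) ⟨⟨hspos.le, by nlinarith⟩, by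
      rw [hsq]; linear_combination (-(1 / 2) * √(1 - 2 * κ / p ^ 2)) * hdiv⟩
    linarith
  · rintro ⟨hle, hw⟩
    refine ⟨⟨⟨h0, h1⟩, by linarith⟩, ?_⟩
    rintro α ⟨⟨hα0, -⟩, hα⟩
    by_contra! hlt
    have hα' : κ = 1 / 2 * (1 - α ^ 2) * p ^ 2 := mul_left_cancel₀ (by linarith : α ≠ 0) hα
    have hp : 0 < p ^ 2 := by
      by_contra! h
      have : p ^ 2 = 0 := le_antisymm h (sq_nonneg p)
      rw [this] at hα'; linarith
    have : 0 < (α ^ 2 - w ^ 2) * p ^ 2 := mul_pos (by nlinarith) hp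
    linarith

theorem normalDeriv_formula_iff (hκ : 0 < κ) (h0 : 0 ≤ w) :
    ((2 * κ < p ^ 2 → w = √(1 - 2 * κ / p ^ 2)) ∧ (¬ 2 * κ < p ^ 2 → w = 0)) ↔
      1 / 2 * (1 - w ^ 2) * p ^ 2 ≤ κ ∧ w * (1 / 2 * (1 - w ^ 2) * p ^ 2 - κ) = 0 := by
  by_cases h : 2 * κ < p ^ 2
  · have hp : 0 < p ^ 2 := by linarith
    have hlt : 2 * κ / p ^ 2 < 1 := by rw [div_lt_one hp]; linarith
    have hsq : √(1 - 2 * κ / p ^ 2) ^ 2 = 1 - 2 * κ / p ^ 2 := Real.sq_sqrt (by linarith)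
    have hspos : 0 < √(1 - 2 * κ / p ^ 2) := Real.sqrt_pos.2 (by linarith)
    have hdiv : 2 * κ / p ^ 2 * p ^ 2 = 2 * κ := div_mul_cancel₀ _ hp.ne'
    refine ⟨fun hw => ?_, fun ⟨hle, hw⟩ => ⟨fun _ => ?_, fun h' => absurd h h'⟩⟩
    · have hG : 1 / 2 * (1 - w ^ 2) * p ^ 2 = κ := by
        rw [hw.1 h, hsq]; linear_combination (1 / 2) * hdiv
      rw [hG]; simp
    · rcases mul_eq_zero.1 hw with hw | hw
      · rw [hw] at hle; linarith
      · rw [eq_comm, ← Real.sqrt_sq h0]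
        congr 1
        rw [sub_eq_iff_eq_add', ← sub_eq_iff_eq_add, eq_div_iff hp.ne']
        linarith
  · simp only [h, not_false_eq_true, false_imp_iff, true_imp_iff, true_and]
    constructor
    · rintro rfl
      constructor <;> nlinarith
    · rintro ⟨-, hw⟩
      rcases mul_eq_zero.1 hw with h' | h'
      · exact h'
      · have : 0 ≤ w ^ 2 * p ^ 2 := by positivity
        have h3 : w ^ 2 * p ^ 2 = 0 := by nlinarith
        have h4 : p ^ 2 ≠ 0 := by intro h5; rw [h5] at h'; linarith
        simpa [h4] using h3

theorem characteristic_formula_iff (hκ : 0 < κ) (h0 : 0 ≤ w) (hq : q = -(w * p)) :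
    w = max (((p - q) ^ 2 - 2 * κ) / ((p - q) ^ 2 + 2 * κ)) 0 ↔
      1 / 2 * (1 - w ^ 2) * p ^ 2 ≤ κ ∧ w * (1 / 2 * (1 - w ^ 2) * p ^ 2 - κ) = 0 := by
  have hs : (p - q) ^ 2 = (1 + w) ^ 2 * p ^ 2 := by rw [hq]; ring
  have hD : 0 < (p - q) ^ 2 + 2 * κ := by positivity
  -- The quotient is compared with `w` after clearing the positive denominator.
  have key : w * ((p - q) ^ 2 + 2 * κ) - ((p - q) ^ 2 - 2 * κ)
      = 2 * (1 + w) * (κ - 1 / 2 * (1 - w ^ 2) * p ^ 2) := by rw [hs]; ring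
  have hw_pos : 0 < 2 * (1 + w) := by linarith
  have hle : ((p - q) ^ 2 - 2 * κ) / ((p - q) ^ 2 + 2 * κ) ≤ w ↔
      1 / 2 * (1 - w ^ 2) * p ^ 2 ≤ κ := by
    rw [div_le_iff₀ hD, ← sub_nonneg, key, mul_nonneg_iff_of_pos_left hw_pos, sub_nonneg]
  have heq : w = ((p - q) ^ 2 - 2 * κ) / ((p - q) ^ 2 + 2 * κ) ↔
      1 / 2 * (1 - w ^ 2) * p ^ 2 - κ = 0 := by
    rw [eq_div_iff hD.ne', ← sub_eq_zero, key, mul_eq_zero, or_iff_right hw_pos.ne', ← neg_eq_zero,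
      neg_sub]
  constructor
  · intro h
    refine ⟨hle.1 ((le_max_left _ _).trans h.symm.le), ?_⟩
    rcases le_total (((p - q) ^ 2 - 2 * κ) / ((p - q) ^ 2 + 2 * κ)) 0 with h' | h'
    · rw [max_eq_right h'] at h; rw [h, zero_mul]
    · rw [max_eq_left h'] at h; rw [heq.1 h, mul_zero]
  · rintro ⟨h1, h2⟩
    have h1 := hle.2 h1
    rcases mul_eq_zero.1 h2 with h | h
    · rw [max_eq_right (by linarith)]; exact h
    · rw [← heq.2 h, max_eq_left h0]

end Pointwise

/-! ### Geometry of the moving domains -/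

section Geometry

variable {N : ℕ} {T : ℝ} {Ω : ℝ → Set (Space N)} {Φ Ψ : ℝ × Space N → Space N}

theorem mem_closure_spaceTime {t : ℝ} (ht : t ∈ Ioo 0 T) {x : Space N} (hx : x ∈ closure (Ω t)) :
    (t, x) ∈ closure (spaceTime T Ω) := by
  have h : MapsTo (fun x : Space N => (t, x)) (Ω t) (spaceTime T Ω) := fun y hy => ⟨ht, hy⟩
  exact h.closure (by fun_prop) hx

namespace IsMovingDiffeo

theorem mapsTo_Φ (h : IsMovingDiffeo T Ω Φ Ψ) {t : ℝ} (ht : t ∈ Icc 0 T) :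
    MapsTo (fun y => Φ (t, y)) (Ω 0) (Ω t) := fun y hy => by
  rw [← h.image_Φ t ht]; exact mem_image_of_mem _ hy

theorem mapsTo_Ψ (h : IsMovingDiffeo T Ω Φ Ψ) {t : ℝ} (ht : t ∈ Icc 0 T) :
    MapsTo (fun x => Ψ (t, x)) (Ω t) (Ω 0) := fun x hx => by
  rw [← h.image_Ψ t ht]; exact mem_image_of_mem _ hx

theorem mapsTo_Φ_closure (h : IsMovingDiffeo T Ω Φ Ψ) {t : ℝ} (ht : t ∈ Icc 0 T) :
    MapsTo (fun y => Φ (t, y)) (closure (Ω 0)) (closure (Ω t)) :=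
  (h.mapsTo_Φ ht).closure_of_continuousOn <|
    h.smooth_Φ.1.continuousOn.comp (by fun_prop) fun _ hy => ⟨ht, hy⟩

theorem mapsTo_Ψ_closure (h : IsMovingDiffeo T Ω Φ Ψ) {t : ℝ} (ht : t ∈ Ioo 0 T) :
    MapsTo (fun x => Ψ (t, x)) (closure (Ω t)) (closure (Ω 0)) :=
  (h.mapsTo_Ψ (Ioo_subset_Icc_self ht)).closure_of_continuousOn <|
    h.smooth_Ψ.1.continuousOn.comp (by fun_prop) fun _ hx => mem_closure_spaceTime ht hx

theorem mem_of_Ψ_mem (h : IsMovingDiffeo T Ω Φ Ψ) {t : ℝ} (ht : t ∈ Ioo 0 T) {x : Space N}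
    (hx : x ∈ closure (Ω t)) (hΨ : Ψ (t, x) ∈ Ω 0) : x ∈ Ω t := by
  rw [← h.right_inv t x (mem_closure_spaceTime ht hx)]
  exact h.mapsTo_Φ (Ioo_subset_Icc_self ht) hΨ

/-- A ball which meets `Ω_t` and in which every limit point of `Ω_t` comes from `Ω_0` lies in
`Ω_t`, because balls are connected. -/
theorem ball_subset (h : IsMovingDiffeo T Ω Φ Ψ) (hopen : ∀ t ∈ Icc 0 T, IsOpen (Ω t))
    {t : ℝ} (ht : t ∈ Ioo 0 T) {x p : Space N} {r : ℝ} (hp : p ∈ Ω t) (hpx : p ∈ Metric.ball x r)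
    (hcl : ∀ x' ∈ Metric.ball x r, x' ∈ closure (Ω t) → Ψ (t, x') ∈ Ω 0) :
    Metric.ball x r ⊆ Ω t :=
  (convex_ball x r).isPreconnected.subset_of_closure_inter_subset
    (hopen t (Ioo_subset_Icc_self ht)) ⟨p, hpx, hp⟩
    fun x' hx' => h.mem_of_Ψ_mem ht hx'.1 (hcl x' hx'.2 hx'.1)

theorem isOpen_spaceTime (h : IsMovingDiffeo T Ω Φ Ψ) (hopen : ∀ t ∈ Icc 0 T, IsOpen (Ω t)) :
    IsOpen (spaceTime T Ω) := by
  rw [isOpen_iff_mem_nhds]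
  rintro ⟨t₀, x₀⟩ ⟨ht₀, hx₀⟩
  simp only at ht₀ hx₀
  have ht₀' := Ioo_subset_Icc_self ht₀
  have h0 : (0 : ℝ) ∈ Icc 0 T := ⟨le_rfl, ht₀'.1.trans ht₀'.2⟩
  have hcl := mem_closure_spaceTime ht₀ (subset_closure hx₀)
  have hy₀ : Ψ (t₀, x₀) ∈ Ω 0 := h.mapsTo_Ψ ht₀' hx₀
  have hΨ : ∀ᶠ z in 𝓝 (t₀, x₀), z ∈ closure (spaceTime T Ω) → Ψ z ∈ Ω 0 :=
    eventually_nhdsWithin_iff.1 <|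
      (h.smooth_Ψ.1.continuousOn _ hcl).eventually ((hopen 0 h0).mem_nhds hy₀)
  obtain ⟨ρ, hρ, hball⟩ := Metric.eventually_nhds_iff_ball.1 hΨ
  have hΦ : ∀ᶠ t in 𝓝 t₀, Φ (t, Ψ (t₀, x₀)) ∈ Metric.ball x₀ ρ := by
    have hc : ContinuousAt (fun t => Φ (t, Ψ (t₀, x₀))) t₀ := by
      have : ContinuousOn (fun t => Φ (t, Ψ (t₀, x₀))) (Icc 0 T) :=
        h.smooth_Φ.1.continuousOn.comp (by fun_prop) fun t ht => ⟨ht, subset_closure hy₀⟩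
      exact this.continuousAt (Icc_mem_nhds ht₀.1 ht₀.2)
    refine hc.eventually (Metric.isOpen_ball.mem_nhds ?_)
    simpa only [h.right_inv t₀ x₀ hcl] using Metric.mem_ball_self hρ
  have hev : ∀ᶠ t in 𝓝 t₀, t ∈ Ioo 0 T ∧ Metric.ball x₀ ρ ⊆ Ω t := by
    filter_upwards [hΦ, Ioo_mem_nhds ht₀.1 ht₀.2, Metric.ball_mem_nhds t₀ hρ] with t h1 h2 h3
    refine ⟨h2, h.ball_subset hopen h2 (h.mapsTo_Φ (Ioo_subset_Icc_self h2) hy₀) h1 ?_⟩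
    intro x' hx' hx'cl
    refine hball (t, x') ?_ (mem_closure_spaceTime h2 hx'cl)
    rw [← ball_prod_same]; exact ⟨h3, hx'⟩
  rw [nhds_prod_eq]
  filter_upwards [hev.prod_mk (Metric.ball_mem_nhds x₀ hρ)] with z hz
  exact ⟨hz.1.1, hz.1.2 hz.2⟩

/-- The displacement of `Φ` in time is linear to first order, uniformly in the point of the
reference domain near a given one. -/
theorem displacement (h : IsMovingDiffeo T Ω Φ Ψ) {t₀ : ℝ} (ht₀ : t₀ ∈ Ioo 0 T) {y₀ : Space N}
    (hy₀ : y₀ ∈ closure (Ω 0)) {δ : ℝ} (hδ : 0 < δ) :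
    ∃ ρ > 0, ∀ t ∈ Metric.ball t₀ ρ, ∀ y ∈ Metric.ball y₀ ρ, t ∈ Icc 0 T → y ∈ closure (Ω 0) →
      ‖Φ (t, y) - Φ (t₀, y) - (t - t₀) • timeDeriv T Φ t₀ y₀‖ ≤ δ * |t - t₀| := by
  have ht₀' := Ioo_subset_Icc_self ht₀
  have hT : 0 < T := ht₀.1.trans ht₀.2
  set S := Icc (0 : ℝ) T ×ˢ closure (Ω 0) with hS
  have hz₀ : (t₀, y₀) ∈ S := ⟨ht₀', hy₀⟩
  have hC1 : ContDiffWithinAt ℝ (0 + 1) Φ S (t₀, y₀) :=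
    (h.smooth_Φ.1 _ hz₀).of_le (by norm_num)
  obtain ⟨u, hu, -, f', hf', hf'c⟩ := (contDiffWithinAt_succ_iff_hasFDerivWithinAt (by simp)).1 hC1
  rw [insert_eq_of_mem hz₀] at hu
  have hz₀u : (t₀, y₀) ∈ u := mem_of_mem_nhdsWithin hz₀ hu
  -- The slice of `u` at `y` gives the derivative of `t ↦ Φ (t, y)`.
  have hslice : ∀ {A : Set ℝ} {t : ℝ} {y : Space N}, (∀ s ∈ A, (s, y) ∈ u) → t ∈ A →
      HasDerivWithinAt (fun s => Φ (s, y)) (f' (t, y) (1, 0)) A t := by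
    intro A t y hA ht
    have h1 : HasDerivWithinAt (fun s : ℝ => (s, y)) ((1 : ℝ), (0 : Space N)) A t :=
      (hasDerivWithinAt_id t A).prodMk (hasDerivWithinAt_const t A y)
    exact (hf' (t, y) (hA t ht)).comp_hasDerivWithinAt t h1 hA
  have hev : ∀ᶠ z in 𝓝[S] (t₀, y₀), z ∈ u ∧ ‖f' z - f' (t₀, y₀)‖ < δ := by
    have hc : ∀ᶠ z in 𝓝[u] (t₀, y₀), ‖f' z - f' (t₀, y₀)‖ < δ := by
      have := Metric.tendsto_nhds.1 hf'c.continuousWithinAt δ hδ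
      simpa only [dist_eq_norm] using this
    have hle : 𝓝[S] (t₀, y₀) ≤ 𝓝[u] (t₀, y₀) := nhdsWithin_le_iff.2 hu
    exact Filter.Eventually.and hu (hle hc)
  obtain ⟨ρ, hρ, hball⟩ := Metric.eventually_nhds_iff_ball.1 (eventually_nhdsWithin_iff.1 hev)
  have hball' : ∀ t ∈ Metric.ball t₀ ρ, ∀ y ∈ Metric.ball y₀ ρ, t ∈ Icc 0 T → y ∈ closure (Ω 0) →
      (t, y) ∈ u ∧ ‖f' (t, y) - f' (t₀, y₀)‖ < δ := by
    intro t ht y hy htI hyc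
    refine hball (t, y) ?_ ⟨htI, hyc⟩
    rw [← ball_prod_same]; exact ⟨ht, hy⟩
  have hV : timeDeriv T Φ t₀ y₀ = f' (t₀, y₀) (1, 0) := by
    set A := Icc (0 : ℝ) T ∩ Metric.ball t₀ ρ
    have hd : HasDerivWithinAt (fun s => Φ (s, y₀)) (f' (t₀, y₀) (1, 0)) A t₀ :=
      hslice (fun s hs => (hball' s hs.2 y₀ (Metric.mem_ball_self hρ) hs.1 hy₀).1)
        ⟨ht₀', Metric.mem_ball_self hρ⟩
    have hA : A ∈ 𝓝 t₀ := inter_mem (Icc_mem_nhds ht₀.1 ht₀.2) (Metric.ball_mem_nhds _ hρ)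
    exact (hd.hasDerivAt hA).hasDerivWithinAt.derivWithin (uniqueDiffOn_Icc hT _ ht₀')
  refine ⟨ρ, hρ, fun t ht y hy htI hyc => ?_⟩
  set A := Icc (0 : ℝ) T ∩ Metric.ball t₀ ρ
  have hconv : Convex ℝ A := (convex_Icc _ _).inter (convex_ball _ _)
  have hderiv : ∀ s ∈ A, HasDerivWithinAt (fun s => Φ (s, y) - s • timeDeriv T Φ t₀ y₀)
      (f' (s, y) (1, 0) - timeDeriv T Φ t₀ y₀) A s := by
    intro s hs
    have h1 := hslice (fun s hs => (hball' s hs.2 y hy hs.1 hyc).1) hs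
    have h2 := (hasDerivWithinAt_id s A).smul_const (timeDeriv T Φ t₀ y₀)
    rw [one_smul] at h2
    exact h1.sub h2
  have hbound : ∀ s ∈ A, ‖f' (s, y) (1, 0) - timeDeriv T Φ t₀ y₀‖ ≤ δ := by
    intro s hs
    rw [hV, ← sub_apply]
    refine ((f' (s, y) - f' (t₀, y₀)).le_opNorm _).trans ?_
    have : ‖((1 : ℝ), (0 : Space N))‖ = 1 := by simp [Prod.norm_def]
    rw [this, mul_one]
    exact (hball' s hs.2 y hy hs.1 hyc).2.le
  have := hconv.norm_image_sub_le_of_norm_hasDerivWithin_le hderiv hbound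
    ⟨ht₀', Metric.mem_ball_self hρ⟩ ⟨htI, ht⟩
  rw [Real.norm_eq_abs] at this
  have hsub : Φ (t, y) - Φ (t₀, y) - (t - t₀) • timeDeriv T Φ t₀ y₀ =
      (Φ (t, y) - t • timeDeriv T Φ t₀ y₀) - (Φ (t₀, y) - t₀ • timeDeriv T Φ t₀ y₀) := by module
  rw [hsub]
  exact this

/-- First-order shape of the space-time domain at a lateral boundary point: up to cones of
arbitrarily small opening, `𝒪` is the half space `(x - x₀) · ν < ω (t - t₀)`, where `ω` is the
normal velocity. The map `Φ(t₀, Ψ(t, ·))` moves `Ω_t` back to `Ω_{t₀}` and is, to first order,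
the translation by `-(t - t₀) V`, so a point of `Ω_t` violating the inequality would be moved
to a point outside `Ω_{t₀}`. The converse inclusion follows with `ball_subset`. -/
theorem spaceTime_normal (h : IsMovingDiffeo T Ω Φ Ψ) (hopen : ∀ t ∈ Icc 0 T, IsOpen (Ω t))
    {t₀ : ℝ} (ht₀ : t₀ ∈ Ioo 0 T) {x₀ ν : Space N} (hx₀ : x₀ ∈ frontier (Ω t₀))
    (hν : IsOuterNormal (Ω t₀) x₀ ν) {ε : ℝ} (hε : 0 < ε) :
    ∀ᶠ z : ℝ × Space N in 𝓝 (t₀, x₀),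
      (⟪z.2 - x₀, ν⟫ - (z.1 - t₀) * ⟪timeDeriv T Φ t₀ (Ψ (t₀, x₀)), ν⟫
        < -(ε * ‖z - (t₀, x₀)‖) → z ∈ spaceTime T Ω) ∧
      (ε * ‖z - (t₀, x₀)‖ <
        ⟪z.2 - x₀, ν⟫ - (z.1 - t₀) * ⟪timeDeriv T Φ t₀ (Ψ (t₀, x₀)), ν⟫ →
          z ∉ spaceTime T Ω) := by
  have ht₀' := Ioo_subset_Icc_self ht₀
  have hx₀c : x₀ ∈ closure (Ω t₀) := frontier_subset_closure hx₀
  have hz₀c := mem_closure_spaceTime ht₀ hx₀c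
  have hy₀ : Ψ (t₀, x₀) ∈ closure (Ω 0) := h.mapsTo_Ψ_closure ht₀ hx₀c
  have hV : ‖timeDeriv T Φ t₀ (Ψ (t₀, x₀))‖ < 1 := h.speed_lt t₀ ht₀' _ hy₀
  set V := timeDeriv T Φ t₀ (Ψ (t₀, x₀)) with hVdef
  set e := min ε 1
  have he : 0 < e := lt_min hε one_pos
  have he1 : e ≤ 1 := min_le_right _ _
  have heε : e ≤ ε := min_le_left _ _
  obtain ⟨ρ₁, hρ₁, hN⟩ := Metric.eventually_nhds_iff_ball.1 (hν.2 (e / 8) (by positivity))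
  obtain ⟨ρ₂, hρ₂, hD⟩ := h.displacement ht₀ hy₀ (δ := e / 8) (by positivity)
  have hΨ : ∀ᶠ z in 𝓝 (t₀, x₀), z ∈ closure (spaceTime T Ω) →
      Ψ z ∈ Metric.ball (Ψ (t₀, x₀)) ρ₂ :=
    eventually_nhdsWithin_iff.1 <|
      (h.smooth_Ψ.1.continuousOn _ hz₀c).eventually (Metric.ball_mem_nhds _ hρ₂)
  obtain ⟨ρ₃, hρ₃, hΨ⟩ := Metric.eventually_nhds_iff_ball.1 hΨ
  have hevI : ∀ᶠ z : ℝ × Space N in 𝓝 (t₀, x₀), z.1 ∈ Ioo 0 T :=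
    continuous_fst.continuousAt.eventually (Ioo_mem_nhds ht₀.1 ht₀.2)
  have hρ : 0 < min (ρ₁ / 4) (min ρ₂ (ρ₃ / 4)) := by positivity
  filter_upwards [hevI, Metric.ball_mem_nhds (t₀, x₀) hρ] with ⟨t, x⟩ ht hz
  rw [Metric.mem_ball, dist_eq_norm] at hz
  simp only at ht ⊢
  have ht' := Ioo_subset_Icc_self ht
  set R := ‖(t, x) - (t₀, x₀)‖ with hR
  have hR₁ : 4 * R < ρ₁ := by linarith [hz.trans_le (min_le_left _ _)]
  have hR₂ : R < ρ₂ := hz.trans_le ((min_le_right _ _).trans (min_le_left _ _))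
  have hR₃ : 4 * R < ρ₃ := by
    linarith [hz.trans_le ((min_le_right _ _).trans (min_le_right _ _))]
  have hR0 : 0 ≤ R := norm_nonneg _
  have htR : |t - t₀| ≤ R := by
    exact norm_fst_le ((t, x) - (t₀, x₀))
  have hxR : ‖x - x₀‖ ≤ R := norm_snd_le ((t, x) - (t₀, x₀))
  have htVR : ‖(t - t₀) • V‖ ≤ R := by
    rw [norm_smul, Real.norm_eq_abs]
    nlinarith [abs_nonneg (t - t₀), norm_nonneg V]
  have htball : t ∈ Metric.ball t₀ ρ₂ := by
    rw [Metric.mem_ball, Real.dist_eq]; exact htR.trans_lt hR₂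
  have hball₃ : ∀ s : ℝ, ∀ x' : Space N, |s - t₀| ≤ R → ‖x' - x₀‖ ≤ 3 * R →
      (s, x') ∈ Metric.ball (t₀, x₀) ρ₃ := by
    intro s x' hs hx'
    rw [← ball_prod_same]
    constructor
    · rw [Metric.mem_ball, Real.dist_eq]; linarith
    · rw [Metric.mem_ball, dist_eq_norm]; linarith
  have hball₁ : ∀ x' : Space N, ‖x' - x₀‖ ≤ 3 * R → x' ∈ Metric.ball x₀ ρ₁ := by
    intro x' hx'
    rw [Metric.mem_ball, dist_eq_norm]; linarith
  -- `x''` is the position at time `t₀` of the particle which is at `x'` at time `t`.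
  have hback : ∀ x' ∈ closure (Ω t), ‖x' - x‖ ≤ e / 4 * R →
      ‖Φ (t₀, Ψ (t, x')) - x₀‖ ≤ 3 * R ∧
      |⟪Φ (t₀, Ψ (t, x')) - x₀, ν⟫ - (⟪x - x₀, ν⟫ - (t - t₀) * ⟪V, ν⟫)|
        ≤ e / 8 * R + ‖x' - x‖ := by
    intro x' hx' hxx'
    have hc := mem_closure_spaceTime ht hx'
    have hx'R : ‖x' - x₀‖ ≤ 3 * R := by
      have : x' - x₀ = (x' - x) + (x - x₀) := by abel
      rw [this]
      refine (norm_add_le _ _).trans ?_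
      nlinarith
    have hd := hD t htball _ (hΨ _ (hball₃ t x' htR hx'R) hc) ht' (h.mapsTo_Ψ_closure ht hx')
    rw [h.right_inv t x' hc] at hd
    have hd' : ‖x' - Φ (t₀, Ψ (t, x')) - (t - t₀) • V‖ ≤ e / 8 * R :=
      hd.trans (mul_le_mul_of_nonneg_left htR (by positivity))
    set w := (x' - x) - (x' - Φ (t₀, Ψ (t, x')) - (t - t₀) • V) with hw
    have hwn : ‖w‖ ≤ e / 8 * R + ‖x' - x‖ := by
      refine (norm_sub_le _ _).trans ?_
      linarith
    have hsub : Φ (t₀, Ψ (t, x')) - x₀ = w + ((x - x₀) - (t - t₀) • V) := by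
      rw [hw]; abel
    constructor
    · rw [hsub]
      refine (norm_add_le _ _).trans ?_
      have := norm_sub_le (x - x₀) ((t - t₀) • V)
      nlinarith
    · have : ⟪Φ (t₀, Ψ (t, x')) - x₀, ν⟫ - (⟪x - x₀, ν⟫ - (t - t₀) * ⟪V, ν⟫) = ⟪w, ν⟫ := by
        rw [hsub, inner_add_left, inner_sub_left (x - x₀), real_inner_smul_left]; ring
      rw [this]
      refine (abs_real_inner_le_norm _ _).trans ?_
      rw [hν.1, mul_one]; exact hwn
  have hR_pos : ⟪x - x₀, ν⟫ - (t - t₀) * ⟪V, ν⟫ ≠ 0 → 0 < R := by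
    refine fun hne => norm_pos_iff.2 fun h0 => hne ?_
    obtain ⟨h1, h2⟩ := Prod.ext_iff.1 (sub_eq_zero.1 h0)
    simp only at h1 h2
    simp [h1, h2]
  constructor
  · intro hlt
    have hRpos := hR_pos (ne_of_lt (hlt.trans_le (by simp; positivity)))
    have hlt' : ⟪x - x₀, ν⟫ - (t - t₀) * ⟪V, ν⟫ < -(e * R) := by nlinarith
    set p := x - (t - t₀) • V with hp
    have hpx : p - x₀ = (x - x₀) - (t - t₀) • V := by rw [hp]; abel
    have hpR : ‖p - x₀‖ ≤ 2 * R := by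
      rw [hpx]; exact (norm_sub_le _ _).trans (by linarith)
    have hpΩ : p ∈ Ω t₀ := by
      refine (hN p (hball₁ p (by linarith))).1 ?_
      rw [hpx, inner_sub_left, real_inner_smul_left, ← hpx]
      nlinarith
    have hpc := mem_closure_spaceTime ht₀ (subset_closure hpΩ)
    have hyp : Ψ (t₀, p) ∈ Ω 0 := h.mapsTo_Ψ ht₀' hpΩ
    have hq := hD t htball _ (hΨ _ (hball₃ t₀ p (by simpa using hR0) (by linarith)) hpc) ht'
      (subset_closure hyp)
    rw [h.right_inv t₀ p hpc] at hq
    have hqx : Φ (t, Ψ (t₀, p)) ∈ Metric.ball x (e / 4 * R) := by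
      rw [Metric.mem_ball, dist_eq_norm]
      have : Φ (t, Ψ (t₀, p)) - x = Φ (t, Ψ (t₀, p)) - p - (t - t₀) • V := by rw [hp]; abel
      rw [this]
      refine hq.trans_lt ?_
      nlinarith
    refine ⟨ht, h.ball_subset hopen ht (h.mapsTo_Φ ht' hyp) hqx (fun x' hx' hx'c => ?_)
      (Metric.mem_ball_self (by positivity))⟩
    rw [Metric.mem_ball, dist_eq_norm] at hx'
    obtain ⟨h1, h2⟩ := hback x' hx'c hx'.le
    have h3 : Φ (t₀, Ψ (t, x')) ∈ Ω t₀ := by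
      refine (hN _ (hball₁ _ h1)).1 ?_
      have := (abs_le.1 h2).2
      nlinarith
    have h4 := h.mapsTo_Ψ ht₀' h3
    simp only at h4
    rwa [h.left_inv t₀ ht₀' _ (h.mapsTo_Ψ_closure ht hx'c)] at h4
  · rintro hlt ⟨-, hxΩ⟩
    simp only at hxΩ
    obtain ⟨h1, h2⟩ := hback x (subset_closure hxΩ) (by simp; positivity)
    rw [sub_self, norm_zero, add_zero] at h2
    have h3 : Φ (t₀, Ψ (t, x)) ∈ Ω t₀ := h.mapsTo_Φ ht₀' (h.mapsTo_Ψ ht' hxΩ)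
    refine (hN _ (hball₁ _ h1)).2 ?_ h3
    have := (abs_le.1 h2).1
    have hRpos := hR_pos (ne_of_gt (hlt.trans_le' (by positivity)))
    nlinarith

/-- The domains grow, so the boundary cannot move inwards: along the trajectory through `x₀`, the
points at times `t < t₀` belong to `closure Ω_{t₀}`. -/
theorem normalVelocity_nonneg (h : IsMovingDiffeo T Ω Φ Ψ)
    (hmono : ∀ s t, 0 ≤ s → s ≤ t → t ≤ T → Ω s ⊆ Ω t)
    {t₀ : ℝ} (ht₀ : t₀ ∈ Ioo 0 T) {x₀ ν : Space N} (hx₀ : x₀ ∈ frontier (Ω t₀))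
    (hν : IsOuterNormal (Ω t₀) x₀ ν) : 0 ≤ ⟪timeDeriv T Φ t₀ (Ψ (t₀, x₀)), ν⟫ := by
  by_contra! hneg
  have ht₀' := Ioo_subset_Icc_self ht₀
  have hx₀c : x₀ ∈ closure (Ω t₀) := frontier_subset_closure hx₀
  have hz₀c := mem_closure_spaceTime ht₀ hx₀c
  have hy₀ : Ψ (t₀, x₀) ∈ closure (Ω 0) := h.mapsTo_Ψ_closure ht₀ hx₀c
  have hV : ‖timeDeriv T Φ t₀ (Ψ (t₀, x₀))‖ < 1 := h.speed_lt t₀ ht₀' _ hy₀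
  have hη1 : -⟪timeDeriv T Φ t₀ (Ψ (t₀, x₀)), ν⟫ < 1 := by
    refine (neg_le_abs _).trans_lt ((abs_real_inner_le_norm _ _).trans_lt ?_)
    rwa [hν.1, mul_one]
  obtain ⟨η, hη⟩ : ∃ η, η = -⟪timeDeriv T Φ t₀ (Ψ (t₀, x₀)), ν⟫ := ⟨_, rfl⟩
  have hη0 : 0 < η := by linarith
  obtain ⟨ρ₁, hρ₁, hN⟩ := Metric.eventually_nhds_iff_ball.1 (hν.2 (η / 4) (by positivity))
  obtain ⟨ρ₂, hρ₂, hD⟩ := h.displacement ht₀ hy₀ (δ := η / 4) (by positivity)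
  obtain ⟨τ, hτ0, hτ⟩ := exists_between (show 0 < min (ρ₁ / 2) (min ρ₂ t₀) from
    lt_min (by positivity) (lt_min hρ₂ ht₀.1))
  have hτ₁ : 2 * τ < ρ₁ := by linarith [hτ.trans_le (min_le_left _ _)]
  have hτ₂ : τ < ρ₂ := hτ.trans_le ((min_le_right _ _).trans (min_le_left _ _))
  have hτ₃ : τ < t₀ := hτ.trans_le ((min_le_right _ _).trans (min_le_right _ _))
  have hs : t₀ - τ ∈ Icc 0 T := ⟨by linarith, by linarith [ht₀.2]⟩
  have hd := hD (t₀ - τ) (by simpa [Real.dist_eq, abs_of_pos hτ0] using hτ₂) _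
    (Metric.mem_ball_self hρ₂) hs hy₀
  rw [h.right_inv t₀ x₀ hz₀c, show t₀ - τ - t₀ = -τ by ring, abs_neg, abs_of_pos hτ0] at hd
  have hpc : Φ (t₀ - τ, Ψ (t₀, x₀)) ∈ closure (Ω t₀) :=
    closure_mono (hmono _ _ hs.1 (by linarith) ht₀'.2) (h.mapsTo_Φ_closure hs hy₀)
  set V := timeDeriv T Φ t₀ (Ψ (t₀, x₀)) with hVdef
  set p := Φ (t₀ - τ, Ψ (t₀, x₀)) with hp
  set w := p - x₀ - (-τ) • V with hw
  have hsub : p - x₀ = w + (-τ) • V := by rw [hw]; abel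
  have hτV : ‖(-τ) • V‖ ≤ τ := by
    rw [norm_smul, norm_neg, Real.norm_eq_abs, abs_of_pos hτ0]; nlinarith [norm_nonneg V]
  have hpn : ‖p - x₀‖ < 2 * τ := by
    rw [hsub]; refine (norm_add_le _ _).trans_lt ?_; nlinarith
  have hpν : 3 / 4 * η * τ ≤ ⟪p - x₀, ν⟫ := by
    have h1 : |⟪w, ν⟫| ≤ η / 4 * τ :=
      (abs_real_inner_le_norm _ _).trans (by rw [hν.1, mul_one]; exact hd)
    rw [hsub, inner_add_left, real_inner_smul_left]
    nlinarith [(abs_le.1 h1).1]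
  -- A neighbourhood of `p` lies in the outer cone at `x₀`.
  have hopen : IsOpen {y | η / 4 * ‖y - x₀‖ < ⟪y - x₀, ν⟫} :=
    isOpen_lt (by fun_prop) (by fun_prop)
  obtain ⟨q, ⟨hq₁, hq₂⟩, hqΩ⟩ := mem_closure_iff.1 hpc _ (hopen.inter Metric.isOpen_ball)
    (⟨by simp only [mem_ofPred_eq]; nlinarith, by rw [Metric.mem_ball, dist_eq_norm]; linarith⟩ :
      p ∈ {y | η / 4 * ‖y - x₀‖ < ⟪y - x₀, ν⟫} ∩ Metric.ball x₀ ρ₁)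
  exact (hN q hq₂).2 hq₁ hqΩ

theorem normalVelocity_lt_one (h : IsMovingDiffeo T Ω Φ Ψ)
    {t₀ : ℝ} (ht₀ : t₀ ∈ Ioo 0 T) {x₀ ν : Space N} (hx₀ : x₀ ∈ frontier (Ω t₀))
    (hν : IsOuterNormal (Ω t₀) x₀ ν) : ⟪timeDeriv T Φ t₀ (Ψ (t₀, x₀)), ν⟫ < 1 := by
  have := h.speed_lt t₀ (Ioo_subset_Icc_self ht₀) _
    (h.mapsTo_Ψ_closure ht₀ (frontier_subset_closure hx₀))
  refine (real_inner_le_norm _ _).trans_lt ?_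
  rwa [hν.1, mul_one]

end IsMovingDiffeo

end Geometry

/-! ### Outer normals of Lipschitz domains -/

section Normal

variable {N : ℕ}

/-- A sublevel set of a function with nonzero differential at a zero has the normalized gradient
as outer normal there. -/
theorem IsOuterNormal.of_hasFDerivAt {U : Set (Space N)} {F : Space N → ℝ} {x n : Space N}
    (hF : HasFDerivAt F (innerSL ℝ n) x) (hn : n ≠ 0) (hx : F x = 0)
    (hU : ∀ᶠ y in 𝓝 x, (y ∈ U ↔ F y < 0)) : IsOuterNormal U x (‖n‖⁻¹ • n) := by
  have hn' : 0 < ‖n‖ := norm_pos_iff.2 hn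
  refine ⟨by rw [norm_smul, norm_inv, norm_norm, inv_mul_cancel₀ hn'.ne'], fun ε hε => ?_⟩
  filter_upwards [hF.isLittleO.def (mul_pos hε hn'), hU] with y hy hyU
  rw [hx, sub_zero, innerSL_apply_apply, Real.norm_eq_abs, abs_le] at hy
  have hin : ⟪y - x, ‖n‖⁻¹ • n⟫ = ‖n‖⁻¹ * ⟪n, y - x⟫ := by
    rw [real_inner_smul_right, real_inner_comm]
  rw [hin, hyU, not_lt]
  constructor
  · intro h
    rw [inv_mul_lt_iff₀ hn'] at h
    nlinarith [hy.2]
  · intro h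
    rw [lt_inv_mul_iff₀ hn'] at h
    nlinarith [hy.1]

/-- Rademacher's theorem for boundaries: a Lipschitz boundary has an outer normal at almost every
point. Locally it is the graph of a Lipschitz function over a hyperplane; the function is
differentiable outside a null set, and the graph map, being Lipschitz, preserves null sets. -/
theorem HasLipschitzBoundary.ae_exists_isOuterNormal {U : Set (Space N)} (hU : IsOpen U)
    (h : HasLipschitzBoundary U) :
    ∀ᵐ x ∂((Measure.hausdorffMeasure ((N : ℝ) - 1)).restrict (frontier U)),
      ∃ ν, IsOuterNormal U x ν := by
  rw [ae_restrict_iff' isClosed_frontier.measurableSet, ae_iff]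
  refine measure_null_of_locally_null _ fun x hx => ?_
  simp only [Classical.not_imp] at hx
  obtain ⟨e, γ, K, hγ, he, hsub⟩ := h x hx.1
  obtain ⟨W, hW, hWo, hxW⟩ := eventually_nhds_iff.1 hsub
  refine ⟨_, inter_mem_nhdsWithin _ (hWo.mem_nhds hxW), ?_⟩
  have he0 : e ≠ 0 := by rintro rfl; simp at he
  set P := (ℝ ∙ e)ᗮ with hP
  have hrank : (Module.finrank ℝ P : ℝ) = (N : ℝ) - 1 := by
    have h1 := Submodule.finrank_add_finrank_orthogonal (ℝ ∙ e)
    rw [finrank_span_singleton he0, finrank_euclideanSpace_fin] at h1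
    have h2 : (1 : ℝ) + (Module.finrank ℝ P : ℝ) = N := by exact_mod_cast h1
    linarith
  have hN : (0 : ℝ) ≤ (N : ℝ) - 1 := by rw [← hrank]; positivity
  have hπ : ∀ y : Space N, ((P.orthogonalProjectionOnto y : P) : Space N) = y - ⟪y, e⟫ • e := by
    intro y
    change (ℝ ∙ e)ᗮ.starProjection y = _
    rw [Submodule.starProjection_orthogonal_val,
      Submodule.starProjection_unit_singleton ℝ he, real_inner_comm]
  have hγP : LipschitzWith K (fun p : P => γ p) := by
    simpa [Function.comp_def] using hγ.comp (LipschitzWith.subtype_val (P : Set (Space N)))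
  set B : Set P := {p | ¬ DifferentiableAt ℝ (fun p : P => γ p) p} with hB
  have hBnull : Measure.hausdorffMeasure ((N : ℝ) - 1) B = 0 := by
    rw [← hrank]
    have := isAddHaarMeasure_hausdorffMeasure (E := P)
    exact hγP.ae_differentiableAt
  have hgraph : LipschitzWith (1 + K * 1) (fun p : P => (p : Space N) + γ p • e) := by
    refine (LipschitzWith.subtype_val (P : Set (Space N))).add ?_
    refine LipschitzWith.of_dist_le_mul fun p q => ?_
    rw [dist_eq_norm, ← sub_smul, norm_smul, he, mul_one, ← dist_eq_norm]
    simpa using hγP.dist_le_mul p q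
  refine measure_mono_null ?_ (le_antisymm ((hgraph.hausdorffMeasure_image_le hN B).trans
    (by rw [hBnull, mul_zero])) zero_le)
  rintro y ⟨hy, hyW⟩
  simp only [Classical.not_imp, mem_ofPred_eq] at hy
  obtain ⟨hyf, hyn⟩ := hy
  have hyγ : ⟪y, e⟫ = γ (y - ⟪y, e⟫ • e) := by
    have hyU : y ∉ U := fun hyU => by
      have := hU.frontier_eq ▸ hyf
      exact this.2 hyU
    refine le_antisymm ?_ (not_lt.1 fun hlt => hyU ((hW y hyW).2 hlt))
    -- Points strictly above the graph are exterior.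
    by_contra! hlt
    have hcont : Continuous fun z : Space N => ⟪z, e⟫ := by fun_prop
    have hev : ∀ᶠ z in 𝓝 y, γ (z - ⟪z, e⟫ • e) < ⟪z, e⟫ ∧ z ∈ W :=
      ((hγ.continuous.comp (by fun_prop : Continuous fun z : Space N =>
        z - ⟪z, e⟫ • e)).continuousAt.eventually_lt hcont.continuousAt hlt).and
        (hWo.mem_nhds hyW)
    obtain ⟨z, hzU, hz1, hz2⟩ :=
      ((mem_closure_iff_frequently.1 (frontier_subset_closure hyf)).and_eventually hev).exists
    exact lt_asymm hz1 ((hW z hz2).1 hzU)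
  refine ⟨P.orthogonalProjectionOnto y, fun hd => hyn ?_, ?_⟩
  · set F : Space N → ℝ := fun z => ⟪z, e⟫ - γ (z - ⟪z, e⟫ • e) with hF
    have hFd : DifferentiableAt ℝ F y := by
      have h1 : DifferentiableAt ℝ (fun z => γ ((P.orthogonalProjectionOnto z : P) : Space N)) y :=
        hd.comp y P.orthogonalProjectionOnto.differentiableAt
      simp only [hπ] at h1
      exact (differentiableAt_id.inner ℝ (differentiableAt_const e)).sub h1
    set n := (InnerProductSpace.toDual ℝ (Space N)).symm (fderiv ℝ F y) with hn
    have hnF : innerSL ℝ n = fderiv ℝ F y := by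
      ext v; simp [hn]
    have hn0 : n ≠ 0 := by
      intro h0
      -- `F` grows with slope `1` in the direction `e`.
      have h1 : HasDerivAt (fun s : ℝ => F (y + s • e)) (fderiv ℝ F y e) 0 :=
        hFd.hasFDerivAt.hasLineDerivAt e
      have h2 : (fun s : ℝ => F (y + s • e)) = fun s => F y + s := by
        funext s
        have h3 : ⟪y + s • e, e⟫ = ⟪y, e⟫ + s := by
          rw [inner_add_left, real_inner_smul_left, real_inner_self_eq_norm_sq, he]; ring
        have h4 : y + s • e - (⟪y, e⟫ + s) • e = y - ⟪y, e⟫ • e := by module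
        simp only [hF, h3, h4]; ring
      rw [h2, ← hnF, h0] at h1
      have h5 := h1.unique ((hasDerivAt_id (0 : ℝ)).const_add (F y))
      simp at h5
    exact ⟨_, IsOuterNormal.of_hasFDerivAt (hnF ▸ hFd.hasFDerivAt) hn0 (by simp [hF, ← hyγ])
      (by filter_upwards [hWo.mem_nhds hyW] with z hz
          rw [hW z hz, hF, sub_neg])⟩
  · simp only [hπ]
    rw [← hyγ, sub_add_cancel]

end Normal

/-! ### Integration by parts in space up to the lateral boundary -/

section Sobolev

variable {N : ℕ}

theorem tendsto_integral_mul_of_L2 {α : Type*} [MeasurableSpace α] {μ : Measure α}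
    {φ : ℕ → α → ℝ} {w k : α → ℝ} (hφ : ∀ n, MemLp (φ n) 2 μ) (hw : MemLp w 2 μ)
    (hk : MemLp k 2 μ)
    (hlim : Tendsto (fun n => eLpNorm (fun z => φ n z - w z) 2 μ) atTop (𝓝 0)) :
    Tendsto (fun n => ∫ z, φ n z * k z ∂μ) atTop (𝓝 (∫ z, w z * k z ∂μ)) := by
  refine tendsto_integral_of_L1' _ (hw.integrable_mul hk).aestronglyMeasurable
    (Eventually.of_forall fun n => (hφ n).integrable_mul hk) ?_
  have h0 : Tendsto (fun n => eLpNorm (fun z => φ n z - w z) 2 μ * eLpNorm k 2 μ) atTop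
      (𝓝 0) := by
    simpa using ENNReal.Tendsto.mul_const hlim (Or.inr hk.eLpNorm_ne_top)
  refine tendsto_of_tendsto_of_tendsto_of_le_of_le tendsto_const_nhds h0 (fun _ => zero_le)
    fun n => ?_
  have := eLpNorm_le_eLpNorm_mul_eLpNorm_of_nnnorm (p := 2) (q := 2) (r := 1)
    ((hφ n).sub hw).aestronglyMeasurable hk.aestronglyMeasurable (fun a b : ℝ => a * b) 1
    (Eventually.of_forall fun z => by simp)
  simp only [ENNReal.coe_one, one_mul, Pi.sub_apply] at this
  refine le_trans (le_of_eq ?_) this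
  congr 1
  funext z
  simp [sub_mul]

theorem memL2_of_continuous {W : Type*} [NormedAddCommGroup W] [NormedSpace ℝ W] [MeasureSpace W]
    [BorelSpace W] [IsFiniteMeasureOnCompacts (volume : Measure W)] {χ : W → ℝ}
    (hχ : Continuous χ) (hc : HasCompactSupport χ) (U : Set W) : MemL2 U χ :=
  (hχ.memLp_of_hasCompactSupport hc).restrict U

theorem integral_mul_fderiv_eq_neg {W : Type*} [NormedAddCommGroup W] [NormedSpace ℝ W]
    [FiniteDimensional ℝ W] [MeasureSpace W] [BorelSpace W]
    [(volume : Measure W).IsAddHaarMeasure] {φ χ : W → ℝ} (hφ : ContDiff ℝ ∞ φ)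
    (hφc : HasCompactSupport φ) (hχ : ContDiff ℝ ∞ χ) (v : W) :
    ∫ z, φ z * fderiv ℝ χ z v = -∫ z, fderiv ℝ φ z v * χ z := by
  have hdφ : Continuous fun z => fderiv ℝ φ z v := (hφ.continuous_fderiv (by simp)).clm_apply
    continuous_const
  have hdχ : Continuous fun z => fderiv ℝ χ z v := (hχ.continuous_fderiv (by simp)).clm_apply
    continuous_const
  refine integral_mul_fderiv_eq_neg_fderiv_mul_of_integrable ?_ ?_ ?_
    (fun x _ => hφ.differentiable (by simp) x) (fun x _ => hχ.differentiable (by simp) x)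
  · exact (hdφ.mul hχ.continuous).integrable_of_hasCompactSupport
      ((hφc.fderiv_apply (𝕜 := ℝ) v).mul_right)
  · exact (hφ.continuous.mul hdχ).integrable_of_hasCompactSupport hφc.mul_right
  · exact (hφ.continuous.mul hχ.continuous).integrable_of_hasCompactSupport hφc.mul_right

/-- A function in `H¹₀(U)` is integrated by parts against test functions which need not vanish on
the boundary of `U`. -/
theorem MemH10.exists_integral_mul_fderiv {U : Set (Space N)} {w : Space N → ℝ}
    (hw : MemH10 U w) (v : Space N) :
    ∃ g, MemL2 U g ∧ ∀ χ : Space N → ℝ, ContDiff ℝ ∞ χ → HasCompactSupport χ →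
      ∫ x in U, w x * fderiv ℝ χ x v = -∫ x in U, g x * χ x := by
  obtain ⟨hw2, φ, hφ, hlim, hg⟩ := hw
  obtain ⟨g, hg2, hglim⟩ := hg v
  refine ⟨g, hg2, fun χ hχ hχc => ?_⟩
  have hdχ : Continuous fun z => fderiv ℝ χ z v := (hχ.continuous_fderiv (by simp)).clm_apply
    continuous_const
  have h1 := tendsto_integral_mul_of_L2
    (fun n => memL2_of_continuous (hφ n).1.continuous (hφ n).2.1 U) hw2
    (memL2_of_continuous hdχ (hχc.fderiv_apply (𝕜 := ℝ) v) U) hlim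
  have h2 := tendsto_integral_mul_of_L2
    (fun n => memL2_of_continuous (((hφ n).1.continuous_fderiv (by simp)).clm_apply
      continuous_const) ((hφ n).2.1.fderiv_apply (𝕜 := ℝ) v) U) hg2
    (memL2_of_continuous hχ.continuous hχc U) hglim
  refine tendsto_nhds_unique h1 ?_
  refine h2.neg.congr fun n => ?_
  have h0 : ∀ x, x ∉ U → φ n x * fderiv ℝ χ x v = 0 := fun x hx => by
    rw [image_eq_zero_of_notMem_tsupport fun h => hx ((hφ n).2.2 h), zero_mul]
  have h0' : ∀ x, x ∉ U → fderiv ℝ (φ n) x v * χ x = 0 := fun x hx => by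
    rw [fderiv_of_notMem_tsupport (𝕜 := ℝ) fun h => hx ((hφ n).2.2 h)]; simp
  rw [setIntegral_eq_integral_of_forall_compl_eq_zero h0,
    setIntegral_eq_integral_of_forall_compl_eq_zero h0',
    integral_mul_fderiv_eq_neg (hφ n).1 (hφ n).2.1 hχ]

/-- Countably many test functions suffice to show that a function in `L²(U)` vanishes. -/
theorem exists_countable_test (U : Set (Space N)) (hU : IsOpen U) :
    ∃ D : Set (Space N → ℝ), D.Countable ∧ D ⊆ testSpace U ∧
      ∀ h : Space N → ℝ, MemL2 U h → (∀ χ ∈ D, ∫ x in U, h x * χ x = 0) →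
        ∀ᵐ x ∂(volume.restrict U), h x = 0 := by
  have hmem : ∀ χ : testSpace U, MemL2 U (χ : Space N → ℝ) := fun χ =>
    memL2_of_continuous χ.2.1.continuous χ.2.2.1 U
  set ι : testSpace U → Lp ℝ 2 (volume.restrict U) := fun χ => (hmem χ).toLp with hι
  have : Fact ((2 : ℝ≥0∞) ≠ ⊤) := ⟨by simp⟩
  have : SecondCountableTopology (Lp ℝ 2 (volume.restrict U)) := inferInstance
  obtain ⟨D, hDsub, hDc, hDd⟩ :=
    (TopologicalSpace.IsSeparable.of_separableSpace (range ι)).exists_countable_dense_subset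
  have hDsub' : ∀ d, ∃ χ : testSpace U, d ∈ D → ι χ = d := fun d => by
    by_cases hd : d ∈ D
    · obtain ⟨χ, hχ⟩ := hDsub hd; exact ⟨χ, fun _ => hχ⟩
    · exact ⟨0, fun h => absurd h hd⟩
  choose j hj using hDsub'
  refine ⟨(fun d => (j d : Space N → ℝ)) '' D, hDc.image _, ?_, fun h hh hD => ?_⟩
  · rintro _ ⟨d, -, rfl⟩; exact (j d).2
  have hinner : ∀ χ : testSpace U, ⟪ι χ, hh.toLp⟫ = ∫ x in U, h x * (χ : Space N → ℝ) x := by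
    intro χ
    rw [L2.inner_def]
    refine integral_congr_ae ?_
    filter_upwards [(hmem χ).coeFn_toLp, hh.coeFn_toLp] with x h1 h2
    rw [hι, h1, h2]; simp
  have hzero : ∀ p ∈ closure D, ⟪p, hh.toLp⟫ = 0 := by
    have hcl : IsClosed {p : Lp ℝ 2 (volume.restrict U) | ⟪p, hh.toLp⟫ = 0} :=
      isClosed_eq (by fun_prop) continuous_const
    refine fun p hp => closure_minimal (fun d hd => ?_) hcl hp
    rw [mem_ofPred_eq, ← hj d hd, hinner]
    exact hD _ ⟨d, hd, rfl⟩
  have hloc : LocallyIntegrableOn h U (volume.restrict U) :=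
    (hh.locallyIntegrable (by norm_num)).locallyIntegrableOn U
  have hae := hU.ae_eq_zero_of_integral_contDiff_smul_eq_zero hloc fun χ h1 h2 h3 => by
    have := hzero _ (hDd ⟨⟨χ, h1, h2, h3⟩, rfl⟩)
    rw [hinner] at this
    simpa [mul_comm] using this
  filter_upwards [hae, ae_restrict_mem hU.measurableSet] with x h1 h2 using h1 h2

end Sobolev

section SpaceTime

variable {N : ℕ} {T : ℝ} {Ω : ℝ → Set (Space N)}

theorem indicator_spaceTime {F : Type*} [Zero F] {t : ℝ} (ht : t ∈ Ioo 0 T)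
    (w : ℝ × Space N → F) (x : Space N) :
    (spaceTime T Ω).indicator w (t, x) = (Ω t).indicator (fun x => w (t, x)) x := by
  by_cases hx : x ∈ Ω t
  · rw [indicator_of_mem hx, indicator_of_mem (show (t, x) ∈ spaceTime T Ω from ⟨ht, hx⟩)]
  · rw [indicator_of_notMem hx, indicator_of_notMem fun h => hx h.2]

theorem setIntegral_spaceTime (hΩ : ∀ t ∈ Ioo 0 T, IsOpen (Ω t)) (hO : IsOpen (spaceTime T Ω))
    {w : ℝ × Space N → ℝ} (hw : IntegrableOn w (spaceTime T Ω)) :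
    ∫ z in spaceTime T Ω, w z = ∫ t in Ioo 0 T, ∫ x in Ω t, w (t, x) := by
  rw [← integral_indicator hO.measurableSet, Measure.volume_eq_prod, integral_prod,
    ← integral_indicator measurableSet_Ioo]
  · congr 1
    funext t
    by_cases ht : t ∈ Ioo 0 T
    · rw [indicator_of_mem ht, ← integral_indicator (hΩ t ht).measurableSet]
      simp_rw [indicator_spaceTime ht]
    · rw [indicator_of_notMem ht]
      have : ∀ x, (spaceTime T Ω).indicator w (t, x) = 0 := fun x =>
        indicator_of_notMem (fun h => ht h.1) _
      simp [this]
  · rw [← Measure.volume_eq_prod]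
    exact (integrable_indicator_iff hO.measurableSet).2 hw

theorem MemL2.slice {F : Type*} [NormedAddCommGroup F]
    (hΩ : ∀ t ∈ Ioo 0 T, IsOpen (Ω t)) (hO : IsOpen (spaceTime T Ω)) {w : ℝ × Space N → F}
    (hw : MemL2 (spaceTime T Ω) w) :
    ∀ᵐ t ∂(volume.restrict (Ioo 0 T)), MemL2 (Ω t) (fun x => w (t, x)) := by
  have h1 : MemLp ((spaceTime T Ω).indicator w) 2 (volume : Measure (ℝ × Space N)) :=
    (memLp_indicator_iff_restrict hO.measurableSet).2 hw
  rw [Measure.volume_eq_prod] at h1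
  have h2 := h1.aestronglyMeasurable.prodMk_left
  have h3 := (h1.integrable_norm_pow (by simp)).prod_right_ae
  filter_upwards [ae_restrict_of_ae h2, ae_restrict_of_ae h3,
    ae_restrict_mem measurableSet_Ioo] with t h2 h3 ht
  have h4 : MemLp (fun x => (spaceTime T Ω).indicator w (t, x)) 2 volume :=
    (memLp_two_iff_integrable_sq_norm h2).2 (by simpa using h3)
  simp_rw [indicator_spaceTime ht] at h4
  exact (memLp_indicator_iff_restrict (hΩ t ht).measurableSet).1 h4

/-- A weak spatial derivative in the space-time domain gives, for almost every time, a weak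
derivative of the slice, tested with a fixed function supported in an earlier domain. -/
theorem IsWeakDeriv.slice (hΩ : ∀ t ∈ Ioo 0 T, IsOpen (Ω t)) (hO : IsOpen (spaceTime T Ω))
    (hmono : ∀ s t, 0 ≤ s → s ≤ t → t ≤ T → Ω s ⊆ Ω t) {w g : ℝ × Space N → ℝ}
    {v : Space N} (hw : MemL2 (spaceTime T Ω) w) (hg : MemL2 (spaceTime T Ω) g)
    (hwg : IsWeakDeriv (spaceTime T Ω) (0, v) w g) {s : ℝ} (hs : s ∈ Ioo 0 T)
    {χ : Space N → ℝ} (hχ : χ ∈ testSpace (Ω s)) :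
    ∀ᵐ t ∂(volume.restrict (Ioo s T)),
      ∫ x in Ω s, (w (t, x) * fderiv ℝ χ x v + g (t, x) * χ x) = 0 := by
  obtain ⟨hχ, hχc, hχs⟩ := hχ
  set P := Ioo s T ×ˢ Ω s with hP
  have hPO : P ⊆ spaceTime T Ω := fun z hz =>
    ⟨⟨hs.1.trans hz.1.1, hz.1.2⟩, hmono s z.1 hs.1.le hz.1.1.le hz.1.2.le hz.2⟩
  have hPm : MeasurableSet P := measurableSet_Ioo.prod (hΩ s hs).measurableSet
  have hprod : (volume.restrict P : Measure (ℝ × Space N)) =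
      (volume.restrict (Ioo s T)).prod (volume.restrict (Ω s)) := by
    rw [Measure.prod_restrict, Measure.volume_eq_prod]
  have hdχ : Continuous fun x => fderiv ℝ χ x v :=
    (hχ.continuous_fderiv (by simp)).clm_apply continuous_const
  -- Multiplication by a bounded function of `x` preserves integrability on the cylinder `P`.
  have hmul : ∀ {a : ℝ × Space N → ℝ} {k : Space N → ℝ}, MemL2 (spaceTime T Ω) a →
      Continuous k → HasCompactSupport k →
      Integrable (fun z : ℝ × Space N => a z * k z.2) (volume.restrict P) := by
    intro a k ha hk hkc
    have h1 : MemLp a 2 (volume.restrict P) := ha.mono_measure (Measure.restrict_mono hPO le_rfl)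
    have h2 : MemLp (fun z : ℝ × Space N => k z.2) 2 (volume.restrict P) := by
      rw [hprod]
      have := (memL2_of_continuous hk hkc (Ω s)).comp_snd (volume.restrict (Ioo s T))
      exact this
    exact h1.integrable_mul h2
  have hint : Integrable (fun z : ℝ × Space N => w z * fderiv ℝ χ z.2 v + g z * χ z.2)
      ((volume.restrict (Ioo s T)).prod (volume.restrict (Ω s))) := by
    rw [← hprod]
    exact (hmul hw hdχ (hχc.fderiv_apply (𝕜 := ℝ) v)).add (hmul hg hχ.continuous hχc)
  have hloc : LocallyIntegrableOn
      (fun t => ∫ x in Ω s, (w (t, x) * fderiv ℝ χ x v + g (t, x) * χ x)) (Ioo s T)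
      (volume.restrict (Ioo s T)) :=
    hint.integral_prod_left.locallyIntegrable.locallyIntegrableOn _
  have hae := isOpen_Ioo.ae_eq_zero_of_integral_contDiff_smul_eq_zero hloc fun θ h1 h2 h3 => by
    have hφ : (fun z : ℝ × Space N => θ z.1 * χ z.2) ∈ testSpace (spaceTime T Ω) := by
      have hsub : tsupport (fun z : ℝ × Space N => θ z.1 * χ z.2) ⊆ tsupport θ ×ˢ tsupport χ := by
        refine closure_minimal (fun z hz => ?_)
          ((isClosed_tsupport θ).prod (isClosed_tsupport χ))
        rw [Function.mem_support] at hz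
        exact ⟨subset_tsupport _ (left_ne_zero_of_mul hz),
          subset_tsupport _ (right_ne_zero_of_mul hz)⟩
      refine ⟨by fun_prop, ?_, hsub.trans ((prod_mono h3 hχs).trans hPO)⟩
      exact (h2.isCompact.prod hχc.isCompact).of_isClosed_subset (isClosed_tsupport _) hsub
    have hzero : ∀ z ∉ P, θ z.1 = 0 ∨ χ z.2 = 0 ∧ fderiv ℝ χ z.2 = 0 := by
      intro z hz
      by_cases hz1 : z.1 ∈ Ioo s T
      · have hz2 : z.2 ∉ tsupport χ := fun h => hz ⟨hz1, hχs h⟩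
        exact Or.inr ⟨image_eq_zero_of_notMem_tsupport hz2, fderiv_of_notMem_tsupport (𝕜 := ℝ) hz2⟩
      · exact Or.inl (image_eq_zero_of_notMem_tsupport fun h => hz1 (h3 h))
    have hfd : ∀ z : ℝ × Space N,
        fderiv ℝ (fun z : ℝ × Space N => θ z.1 * χ z.2) z (0, v) = θ z.1 * fderiv ℝ χ z.2 v := by
      intro z
      have hθd : HasFDerivAt (fun z : ℝ × Space N => θ z.1) _ z :=
        ((h1.differentiable (by simp) z.1).hasFDerivAt).comp z hasFDerivAt_fst
      have hχd : HasFDerivAt (fun z : ℝ × Space N => χ z.2) _ z :=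
        ((hχ.differentiable (by simp) z.2).hasFDerivAt).comp z hasFDerivAt_snd
      rw [(hθd.fun_mul hχd).fderiv]
      simp
    have hweak := hwg _ hφ
    simp_rw [hfd] at hweak
    rw [setIntegral_eq_of_subset_of_forall_sdiff_eq_zero hO.measurableSet hPO
        (fun z hz => by rcases hzero z hz.2 with h | h <;> simp [h]),
      setIntegral_eq_of_subset_of_forall_sdiff_eq_zero hO.measurableSet hPO
        (fun z hz => by rcases hzero z hz.2 with h | h <;> simp [h])] at hweak
    obtain ⟨C, hC⟩ := h1.continuous.bounded_above_of_compact_support h2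
    have hbdd : ∀ {a : ℝ × Space N → ℝ}, Integrable a (volume.restrict P) →
        Integrable (fun z => θ z.1 * a z) (volume.restrict P) := fun ha =>
      ha.bdd_mul (c := C) (h1.continuous.comp continuous_fst).aestronglyMeasurable
        (Eventually.of_forall fun z => hC z.1)
    have hi1 := hbdd (hmul hw hdχ (hχc.fderiv_apply (𝕜 := ℝ) v))
    have hi2 := hbdd (hmul hg hχ.continuous hχc)
    calc ∫ t in Ioo s T, θ t • ∫ x in Ω s, (w (t, x) * fderiv ℝ χ x v + g (t, x) * χ x)
        = ∫ t in Ioo s T, ∫ x in Ω s, θ t * (w (t, x) * fderiv ℝ χ x v + g (t, x) * χ x) := by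
          simp_rw [smul_eq_mul, integral_const_mul]
      _ = ∫ z in P, θ z.1 * (w z * fderiv ℝ χ z.2 v + g z * χ z.2) := by
          rw [hprod, integral_prod]
          rw [← hprod] at hint ⊢
          exact hbdd hint
      _ = (∫ z in P, w z * (θ z.1 * fderiv ℝ χ z.2 v)) + ∫ z in P, g z * (θ z.1 * χ z.2) := by
          simp_rw [mul_add]
          rw [integral_add hi1 hi2]
          simp_rw [mul_left_comm]
      _ = 0 := by rw [hweak]; ring
  filter_upwards [hae, ae_restrict_mem measurableSet_Ioo] with t h1 h2 using h1 h2

/-- For almost every time, the slice of the weak spatial gradient is the gradient given by the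
approximation of the slice in `H¹₀`: both have the same integrals against the test functions of all
earlier domains, and `Ω_t` is the union of those at earlier rational times, since `𝒪` is open. -/
theorem MemEnergySpace.ae_integral_mul_fderiv (hΩ : ∀ t ∈ Ioo 0 T, IsOpen (Ω t))
    (hO : IsOpen (spaceTime T Ω)) (hmono : ∀ s t, 0 ≤ s → s ≤ t → t ≤ T → Ω s ⊆ Ω t)
    {u ut : ℝ × Space N → ℝ} {gu : ℝ × Space N → Space N} (hu : MemEnergySpace T Ω u ut gu)
    (v : Space N) :
    ∀ᵐ t ∂(volume.restrict (Ioo 0 T)), ∀ χ : Space N → ℝ, ContDiff ℝ ∞ χ → HasCompactSupport χ →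
      ∫ x in Ω t, u (t, x) * fderiv ℝ χ x v = -∫ x in Ω t, ⟪gu (t, x), v⟫ * χ x := by
  have hg : MemL2 (spaceTime T Ω) (fun z => ⟪gu z, v⟫) := hu.memL2_grad.inner_const v
  have hD : ∀ s : ℝ, ∃ D : Set (Space N → ℝ), s ∈ Ioo 0 T → D.Countable ∧ D ⊆ testSpace (Ω s) ∧
      ∀ h : Space N → ℝ, MemL2 (Ω s) h → (∀ χ ∈ D, ∫ x in Ω s, h x * χ x = 0) →
        ∀ᵐ x ∂(volume.restrict (Ω s)), h x = 0 := fun s => by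
    by_cases hs : s ∈ Ioo 0 T
    · obtain ⟨D, h⟩ := exists_countable_test (Ω s) (hΩ s hs); exact ⟨D, fun _ => h⟩
    · exact ⟨∅, fun h => absurd h hs⟩
  choose D hD using hD
  have hslice : ∀ᵐ t ∂(volume.restrict (Ioo 0 T)), ∀ q : ℚ, (q : ℝ) ∈ Ioo 0 T → (q : ℝ) < t →
      ∀ χ ∈ D q, ∫ x in Ω q, (u (t, x) * fderiv ℝ χ x v + ⟪gu (t, x), v⟫ * χ x) = 0 := by
    rw [ae_all_iff]
    intro q
    by_cases hq : (q : ℝ) ∈ Ioo 0 T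
    · have h1 : ∀ᵐ t ∂(volume.restrict (Ioo (q : ℝ) T)), ∀ χ ∈ D q,
          ∫ x in Ω q, (u (t, x) * fderiv ℝ χ x v + ⟪gu (t, x), v⟫ * χ x) = 0 :=
        (ae_ball_iff (hD q hq).1).2 fun χ hχ =>
          (hu.weakDeriv_space v).slice hΩ hO hmono hu.memL2 hg hq ((hD q hq).2.1 hχ)
      rw [ae_restrict_iff' measurableSet_Ioo] at h1 ⊢
      filter_upwards [h1] with t h1 ht _ hqt using h1 ⟨hqt, ht.2⟩
    · exact Eventually.of_forall fun t h => absurd h hq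
  filter_upwards [hslice, hu.zero_boundary, hg.slice hΩ hO, ae_restrict_mem measurableSet_Ioo]
    with t hslice hzero hgt ht
  obtain ⟨g, hg2, hgχ⟩ := hzero.exists_integral_mul_fderiv v
  have heq : ∀ᵐ x ∂(volume.restrict (Ω t)), ⟪gu (t, x), v⟫ - g x = 0 := by
    have hq : ∀ q : ℚ, (q : ℝ) ∈ Ioo 0 t →
        ∀ᵐ x ∂(volume.restrict (Ω q)), ⟪gu (t, x), v⟫ - g x = 0 := by
      intro q hq
      have hqT : (q : ℝ) ∈ Ioo 0 T := ⟨hq.1, hq.2.trans ht.2⟩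
      have hsub : Ω q ⊆ Ω t := hmono q t hq.1.le hq.2.le ht.2.le
      have hle : volume.restrict (Ω q) ≤ volume.restrict (Ω t) :=
        Measure.restrict_mono hsub le_rfl
      obtain ⟨-, hDs, hDt⟩ := hD q hqT
      refine hDt _ ((hgt.sub hg2).mono_measure hle) fun χ hχ => ?_
      have hχt := hDs hχ
      have hdχ : Continuous fun x => fderiv ℝ χ x v :=
        (hχt.1.continuous_fderiv (by simp)).clm_apply continuous_const
      have hχ2 := memL2_of_continuous hχt.1.continuous hχt.2.1 (Ω q)
      have hdχ2 := memL2_of_continuous hdχ (hχt.2.1.fderiv_apply (𝕜 := ℝ) v) (Ω q)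
      have h1 := hslice q hqT hq.2 χ hχ
      have h2 := hgχ χ hχt.1 hχt.2.1
      have h0 : ∀ x ∈ Ω t \ Ω q, χ x = 0 ∧ fderiv ℝ χ x = 0 := fun x hx => by
        have hx' : x ∉ tsupport χ := fun h => hx.2 (hχt.2.2 h)
        exact ⟨image_eq_zero_of_notMem_tsupport hx', fderiv_of_notMem_tsupport (𝕜 := ℝ) hx'⟩
      rw [setIntegral_eq_of_subset_of_forall_sdiff_eq_zero (hΩ t ht).measurableSet hsub
          (fun x hx => by simp [(h0 x hx).2]),
        setIntegral_eq_of_subset_of_forall_sdiff_eq_zero (hΩ t ht).measurableSet hsub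
          (fun x hx => by simp [(h0 x hx).1])] at h2
      have hi1 : Integrable (fun x => u (t, x) * fderiv ℝ χ x v) (volume.restrict (Ω q)) :=
        MemLp.integrable_mul (hzero.1.mono_measure hle) hdχ2
      have hi2 : Integrable (fun x => ⟪gu (t, x), v⟫ * χ x) (volume.restrict (Ω q)) :=
        MemLp.integrable_mul (hgt.mono_measure hle) hχ2
      have hi3 : Integrable (fun x => g x * χ x) (volume.restrict (Ω q)) :=
        MemLp.integrable_mul (hg2.mono_measure hle) hχ2
      rw [integral_add hi1 hi2] at h1
      calc ∫ x in Ω q, (⟪gu (t, x), v⟫ - g x) * χ x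
          = (∫ x in Ω q, ⟪gu (t, x), v⟫ * χ x) - ∫ x in Ω q, g x * χ x := by
            simp_rw [sub_mul]; exact integral_sub hi2 hi3
        _ = 0 := by linarith
    have hunion : Ω t ⊆ ⋃ q : ℚ, ⋃ _ : (q : ℝ) ∈ Ioo 0 t, Ω q := by
      intro x hx
      have hev : ∀ᶠ s in 𝓝 t, (s, x) ∈ spaceTime T Ω :=
        (by fun_prop : Continuous fun s : ℝ => (s, x)).continuousAt.eventually
          (hO.mem_nhds ⟨ht, hx⟩)
      obtain ⟨a, ha, hsub⟩ := exists_Ioc_subset_of_mem_nhds hev ⟨0, ht.1⟩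
      obtain ⟨q, hq1, hq2⟩ := exists_rat_btwn (max_lt ha ht.1)
      exact mem_iUnion₂.2 ⟨q, ⟨(le_max_right _ _).trans_lt hq1, hq2⟩,
        (hsub ⟨(le_max_left _ _).trans_lt hq1, hq2.le⟩ : (_, x) ∈ spaceTime T Ω).2⟩
    refine ae_restrict_of_ae_restrict_of_subset hunion ?_
    rw [ae_restrict_iUnion_iff]
    intro q
    by_cases hqt : (q : ℝ) ∈ Ioo 0 t
    · simpa [hqt] using hq q hqt
    · simp [hqt]
  intro χ hχ hχc
  rw [hgχ χ hχ hχc]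
  congr 1
  refine integral_congr_ae ?_
  filter_upwards [heq] with x hx
  rw [sub_eq_zero.1 hx]

/-- The spatial gradient of a function in the energy space is integrated by parts against test
functions which need not vanish on the lateral boundary. -/
theorem MemEnergySpace.integral_mul_fderiv (hΩ : ∀ t ∈ Ioo 0 T, IsOpen (Ω t))
    (hO : IsOpen (spaceTime T Ω)) (hmono : ∀ s t, 0 ≤ s → s ≤ t → t ≤ T → Ω s ⊆ Ω t)
    {u ut : ℝ × Space N → ℝ} {gu : ℝ × Space N → Space N} (hu : MemEnergySpace T Ω u ut gu)
    (v : Space N) {Θ : ℝ × Space N → ℝ} (hΘ : ContDiff ℝ ∞ Θ) (hΘc : HasCompactSupport Θ) :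
    ∫ z in spaceTime T Ω, u z * fderiv ℝ Θ z (0, v)
      = -∫ z in spaceTime T Ω, ⟪gu z, v⟫ * Θ z := by
  have hg : MemL2 (spaceTime T Ω) (fun z => ⟪gu z, v⟫) := hu.memL2_grad.inner_const v
  have hdΘ : Continuous fun z => fderiv ℝ Θ z (0, v) :=
    (hΘ.continuous_fderiv (by simp)).clm_apply continuous_const
  have hi1 : IntegrableOn (fun z => u z * fderiv ℝ Θ z (0, v)) (spaceTime T Ω) :=
    MemLp.integrable_mul hu.memL2 (memL2_of_continuous hdΘ (hΘc.fderiv_apply (𝕜 := ℝ) (0, v)) _)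
  have hi2 : IntegrableOn (fun z => ⟪gu z, v⟫ * Θ z) (spaceTime T Ω) :=
    MemLp.integrable_mul hg (memL2_of_continuous hΘ.continuous hΘc _)
  rw [setIntegral_spaceTime hΩ hO hi1, setIntegral_spaceTime hΩ hO hi2, ← integral_neg]
  refine integral_congr_ae ?_
  filter_upwards [hu.ae_integral_mul_fderiv hΩ hO hmono v] with t ht
  have hχ : ContDiff ℝ ∞ fun x => Θ (t, x) := by fun_prop
  have hχc : HasCompactSupport fun x => Θ (t, x) :=
    HasCompactSupport.intro (hΘc.isCompact.image continuous_snd) fun x hx =>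
      image_eq_zero_of_notMem_tsupport fun h => hx ⟨(t, x), h, rfl⟩
  rw [← ht _ hχ hχc]
  congr 1
  funext x
  have h1 : HasFDerivAt (fun x : Space N => (t, x)) (ContinuousLinearMap.inr ℝ ℝ (Space N)) x :=
    hasFDerivAt_prodMk_right t x
  have h2 := (hΘ.differentiable (by simp) (t, x)).hasFDerivAt.comp x h1
  have h3 : fderiv ℝ (fun x => Θ (t, x)) x = _ := h2.fderiv
  rw [h3]; simp

end SpaceTime

/-! ### Blow-up at a boundary point -/

section BlowUp

theorem HasTraceAt.clm_apply {W : Type*} [NormedAddCommGroup W] [MeasureSpace W] {F : Type*} [NormedAddCommGroup F] [NormedSpace ℝ F] {U : Set W}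
    {w : W → F} {z : W} {a : F} (h : HasTraceAt U w z a) (L : F →L[ℝ] ℝ) :
    HasTraceAt U (fun y => L (w y)) z (L a) := by
  have h0 := ENNReal.Tendsto.const_mul (a := ‖L‖ₑ) h (Or.inr enorm_ne_top)
  rw [mul_zero] at h0
  refine tendsto_of_tendsto_of_tendsto_of_le_of_le tendsto_const_nhds h0 (fun _ => zero_le)
    fun r => ?_
  simp only [setLAverage_eq]
  rw [← mul_div_assoc, ← lintegral_const_mul' _ _ enorm_ne_top]
  gcongr with y
  rw [← map_sub]
  exact L.le_opENorm _

variable {W : Type*} [NormedAddCommGroup W] [NormedSpace ℝ W] [MeasureSpace W]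
  [FiniteDimensional ℝ W] [BorelSpace W] [(volume : Measure W).IsAddHaarMeasure]

theorem setIntegral_comp_blowup (U : Set W) (hU : MeasurableSet U) (Θ : W → ℝ) (z : W) {r : ℝ}
    (hr : 0 < r) :
    ∫ x in U, Θ (r⁻¹ • (x - z)) =
      r ^ Module.finrank ℝ W * ∫ ζ, ((fun ζ => z + r • ζ) ⁻¹' U).indicator Θ ζ := by
  rw [← integral_indicator hU, ← integral_add_left_eq_self _ z]
  have h := Measure.integral_comp_inv_smul (volume : Measure W)
    (((fun ζ => z + r • ζ) ⁻¹' U).indicator Θ) r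
  rw [abs_of_pos (by positivity), smul_eq_mul] at h
  rw [← h]
  congr 1
  funext y
  have hy : r • r⁻¹ • y = y := smul_inv_smul₀ hr.ne' y
  by_cases hyU : z + y ∈ U
  · rw [indicator_of_mem hyU, indicator_of_mem (by simpa [hy] using hyU), add_sub_cancel_left]
  · rw [indicator_of_notMem hyU, indicator_of_notMem (by simpa [hy] using hyU)]

/-- If `U` blows up to `H` at `z` and `w` has the trace `a` at `z`, then the integrals of `w` against
rescaled test functions converge to those of `a` over `H`. -/
theorem HasTraceAt.tendsto_blowup {U H : Set W} (hU : MeasurableSet U) (hH : MeasurableSet H)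
    {w : W → ℝ} (hw : MemL2 U w) {z : W} {a : ℝ} (h : HasTraceAt U w z a)
    (hUH : ∀ᵐ ζ, ∀ᶠ r in 𝓝[>] (0 : ℝ), (z + r • ζ ∈ U ↔ ζ ∈ H)) {Θ : W → ℝ}
    (hΘ : Continuous Θ) (hΘc : HasCompactSupport Θ) :
    Tendsto (fun r : ℝ => (r ^ Module.finrank ℝ W)⁻¹ * ∫ x in U, w x * Θ (r⁻¹ • (x - z)))
      (𝓝[>] 0) (𝓝 (a * ∫ ζ in H, Θ ζ)) := by
  set d := Module.finrank ℝ W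
  obtain ⟨C, hC⟩ := hΘ.bounded_above_of_compact_support hΘc
  obtain ⟨R, hR, hΘR⟩ : ∃ R > 0, ∀ ζ, ζ ∉ Metric.ball (0 : W) R → Θ ζ = 0 := by
    obtain ⟨R, hR⟩ := hΘc.isCompact.isBounded.subset_ball_lt 0 0
    exact ⟨R, hR.1, fun ζ hζ => image_eq_zero_of_notMem_tsupport fun h => hζ (hR.2 h)⟩
  have hΘr : ∀ r : ℝ, 0 < r → Continuous (fun x => Θ (r⁻¹ • (x - z))) ∧
      HasCompactSupport (fun x => Θ (r⁻¹ • (x - z))) := fun r hr =>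
    ⟨by fun_prop, by
      simpa [Function.comp_def, sub_eq_add_neg] using hΘc.comp_homeomorph
        ((Homeomorph.addRight (-z)).trans (Homeomorph.smulOfNeZero r⁻¹ (inv_ne_zero hr.ne')))⟩
  have hlim1 : Tendsto (fun r : ℝ => (r ^ d)⁻¹ * ∫ x in U, Θ (r⁻¹ • (x - z))) (𝓝[>] 0)
      (𝓝 (∫ ζ in H, Θ ζ)) := by
    have hlim : Tendsto (fun r : ℝ => ∫ ζ, ((fun ζ => z + r • ζ) ⁻¹' U).indicator Θ ζ) (𝓝[>] 0)
        (𝓝 (∫ ζ, H.indicator Θ ζ)) := by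
      refine tendsto_integral_filter_of_dominated_convergence (fun ζ => ‖Θ ζ‖) ?_ ?_ ?_ ?_
      · refine Eventually.of_forall fun r => ?_
        exact hΘ.aestronglyMeasurable.indicator
          (hU.preimage (by fun_prop : Continuous fun ζ : W => z + r • ζ).measurable)
      · exact Eventually.of_forall fun r => Eventually.of_forall fun ζ =>
          norm_indicator_le_norm_self _ _
      · exact (hΘ.integrable_of_hasCompactSupport hΘc).norm
      · filter_upwards [hUH] with ζ hζ
        refine tendsto_const_nhds.congr' ?_
        filter_upwards [hζ] with r hr
        by_cases hζH : ζ ∈ H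
        · rw [indicator_of_mem hζH, indicator_of_mem (show ζ ∈ (fun ζ => z + r • ζ) ⁻¹' U from hr.2 hζH)]
        · rw [indicator_of_notMem hζH, indicator_of_notMem
            (show ζ ∉ (fun ζ => z + r • ζ) ⁻¹' U from fun h => hζH (hr.1 h))]
    rw [integral_indicator hH] at hlim
    refine hlim.congr' ?_
    filter_upwards [self_mem_nhdsWithin] with r hr
    rw [setIntegral_comp_blowup U hU Θ z hr, inv_mul_cancel_left₀ (pow_ne_zero _ (ne_of_gt hr))]
  -- The error is controlled by the averages of `|w - a|` over `U ∩ B_{rR}(z)`.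
  have hlim2 : Tendsto (fun r : ℝ => (r ^ d)⁻¹ * ∫ x in U, (w x - a) * Θ (r⁻¹ • (x - z)))
      (𝓝[>] 0) (𝓝 0) := by
    set A : ℝ → ℝ≥0∞ := fun r => ⨍⁻ y in U ∩ Metric.ball z r, ‖w y - a‖ₑ ∂volume with hA
    set M : ℝ≥0∞ := ENNReal.ofReal C * (ENNReal.ofReal (R ^ d) * volume (Metric.ball (0 : W) 1))
      with hM
    have hMt : M ≠ ⊤ := ENNReal.mul_ne_top ENNReal.ofReal_ne_top
      (ENNReal.mul_ne_top ENNReal.ofReal_ne_top measure_ball_lt_top.ne)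
    have hAR : Tendsto (fun r => M * A (r * R)) (𝓝[>] 0) (𝓝 0) := by
      have h1 : Tendsto (fun r : ℝ => r * R) (𝓝[>] 0) (𝓝[>] 0) := by
        refine tendsto_nhdsWithin_iff.2 ⟨?_, ?_⟩
        · have : Tendsto (fun r : ℝ => r * R) (𝓝 0) (𝓝 (0 * R)) := tendsto_id.mul_const R
          rw [zero_mul] at this
          exact this.mono_left nhdsWithin_le_nhds
        · filter_upwards [self_mem_nhdsWithin] with r hr using mul_pos hr hR
      simpa using ENNReal.Tendsto.const_mul (h.comp h1) (Or.inr hMt)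
    rw [tendsto_zero_iff_norm_tendsto_zero]
    have hreal := (ENNReal.tendsto_toReal ENNReal.zero_ne_top).comp hAR
    rw [ENNReal.toReal_zero] at hreal
    have hfin : ∀ᶠ r in 𝓝[>] (0 : ℝ), M * A (r * R) < ⊤ := hAR.eventually_lt_const (by simp)
    refine squeeze_zero' (Eventually.of_forall fun _ => norm_nonneg _) ?_ hreal
    filter_upwards [hfin, self_mem_nhdsWithin] with r hr hr0
    replace hr0 : 0 < r := hr0
    rw [Function.comp_apply, ← ENNReal.ofReal_le_iff_le_toReal hr.ne, ofReal_norm, enorm_mul]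
    have hsub : ∀ x, ‖(w x - a) * Θ (r⁻¹ • (x - z))‖ₑ ≤
        (Metric.ball z (r * R)).indicator (fun x => ENNReal.ofReal C * ‖w x - a‖ₑ) x := by
      intro x
      by_cases hx : x ∈ Metric.ball z (r * R)
      · rw [indicator_of_mem hx, enorm_mul, mul_comm]
        gcongr
        rw [← ofReal_norm]
        exact ENNReal.ofReal_le_ofReal (hC _)
      · have : Θ (r⁻¹ • (x - z)) = 0 := by
          refine hΘR _ fun h' => hx ?_
          rw [mem_ball_zero_iff, norm_smul, norm_inv, Real.norm_eq_abs, abs_of_pos hr0,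
            inv_mul_lt_iff₀ hr0] at h'
          rwa [Metric.mem_ball, dist_eq_norm]
        simp [this]
    have hint : ‖∫ x in U, (w x - a) * Θ (r⁻¹ • (x - z))‖ₑ ≤
        ENNReal.ofReal C * (volume (Metric.ball z (r * R)) * A (r * R)) := by
      calc ‖∫ x in U, (w x - a) * Θ (r⁻¹ • (x - z))‖ₑ
          ≤ ∫⁻ x in U, ‖(w x - a) * Θ (r⁻¹ • (x - z))‖ₑ := enorm_integral_le_lintegral_enorm _
        _ ≤ ∫⁻ x in U, (Metric.ball z (r * R)).indicator
              (fun x => ENNReal.ofReal C * ‖w x - a‖ₑ) x := lintegral_mono hsub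
        _ = ENNReal.ofReal C * ∫⁻ x in U ∩ Metric.ball z (r * R), ‖w x - a‖ₑ := by
          rw [lintegral_indicator Metric.isOpen_ball.measurableSet,
            Measure.restrict_restrict Metric.isOpen_ball.measurableSet, inter_comm,
            lintegral_const_mul' _ _ ENNReal.ofReal_ne_top]
        _ = ENNReal.ofReal C * (volume (U ∩ Metric.ball z (r * R)) * A (r * R)) := by
          rw [hA, measure_mul_setLAverage]
          exact (measure_mono inter_subset_right).trans_lt measure_ball_lt_top |>.ne
        _ ≤ _ := by gcongr; exact inter_subset_right
    calc ‖(r ^ d)⁻¹‖ₑ * ‖∫ x in U, (w x - a) * Θ (r⁻¹ • (x - z))‖ₑ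
        ≤ ‖(r ^ d)⁻¹‖ₑ * (ENNReal.ofReal C * (volume (Metric.ball z (r * R)) * A (r * R))) := by
          gcongr
      _ = M * A (r * R) := by
          rw [Measure.addHaar_ball_of_pos _ _ (by positivity), mul_pow,
            ENNReal.ofReal_mul (by positivity), hM, ← ofReal_norm, Real.norm_eq_abs,
            abs_of_pos (by positivity), ENNReal.ofReal_inv_of_pos (by positivity)]
          have h1 : (ENNReal.ofReal (r ^ d))⁻¹ * ENNReal.ofReal (r ^ d) = 1 :=
            ENNReal.inv_mul_cancel (by simp; positivity) ENNReal.ofReal_ne_top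
          calc _ = (ENNReal.ofReal (r ^ d))⁻¹ * ENNReal.ofReal (r ^ d) * (ENNReal.ofReal C *
                (ENNReal.ofReal (R ^ d) * volume (Metric.ball (0 : W) 1)) * A (r * R)) := by ring
            _ = _ := by rw [h1, one_mul]
  have hsum := hlim2.add (hlim1.const_mul a)
  rw [zero_add] at hsum
  refine hsum.congr' ?_
  filter_upwards [self_mem_nhdsWithin] with r hr
  obtain ⟨h1, h2⟩ := hΘr r hr
  have hi1 : Integrable (fun x => w x * Θ (r⁻¹ • (x - z))) (volume.restrict U) :=
    MemLp.integrable_mul hw (memL2_of_continuous h1 h2 U)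
  have hi2 : Integrable (fun x => a * Θ (r⁻¹ • (x - z))) (volume.restrict U) :=
    ((h1.integrable_of_hasCompactSupport h2).restrict).const_mul a
  simp_rw [sub_mul]
  rw [integral_sub hi1 hi2, integral_const_mul]
  ring

end BlowUp

/-! ### Test functions adapted to a moving hyperplane -/

section Profile

/-- A smooth step from `0` to `1`, constant outside `[-3/4, -1/2]`. -/
noncomputable def stepUp (s : ℝ) : ℝ := Real.smoothTransition (4 * s + 3)

/-- A smooth function supported in `[-3/4, 3/4]` which agrees with `stepUp` on `(-∞, 1/2]`. -/
noncomputable def plateau (s : ℝ) : ℝ := stepUp s * Real.smoothTransition (3 - 4 * s)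

/-- The bump function at `0` with radii `1/2` and `1`. -/
noncomputable def unitBump (E : Type*) [NormedAddCommGroup E] : ContDiffBump (0 : E) :=
  ⟨1 / 2, 1, by norm_num, by norm_num⟩

theorem contDiff_stepUp : ContDiff ℝ ∞ stepUp :=
  Real.smoothTransition.contDiff.comp (by fun_prop : ContDiff ℝ ∞ fun s : ℝ => 4 * s + 3)

theorem contDiff_plateau : ContDiff ℝ ∞ plateau :=
  contDiff_stepUp.mul
    (Real.smoothTransition.contDiff.comp (by fun_prop : ContDiff ℝ ∞ fun s : ℝ => 3 - 4 * s))

theorem ContDiff.deriv_top {η : ℝ → ℝ} (h : ContDiff ℝ ∞ η) : ContDiff ℝ ∞ (deriv η) :=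
  (contDiff_infty_iff_deriv.1 h).2

theorem deriv_eq_zero_of_isOpen {η : ℝ → ℝ} {s c : ℝ} {A : Set ℝ} (hA : IsOpen A)
    (h : ∀ s ∈ A, η s = c) (hs : s ∈ A) : deriv η s = 0 := by
  have : η =ᶠ[𝓝 s] fun _ => c := by filter_upwards [hA.mem_nhds hs] with x hx using h x hx
  rw [this.deriv_eq, deriv_const]

theorem isOpen_one_lt_abs : IsOpen {s : ℝ | 1 < |s|} := isOpen_lt continuous_const continuous_abs

theorem deriv_eq_zero_of_one_lt_abs {η : ℝ → ℝ} (h : ∀ s, 1 < |s| → η s = 0) :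
    ∀ s, 1 < |s| → deriv η s = 0 := fun _ hs =>
  deriv_eq_zero_of_isOpen isOpen_one_lt_abs (fun s hs => h s hs) hs

theorem deriv_stepUp_eq_zero_of_gt {s : ℝ} (hs : -(1 / 2) < s) : deriv stepUp s = 0 :=
  deriv_eq_zero_of_isOpen (c := 1) isOpen_Ioi
    (fun s hs => Real.smoothTransition.one_of_one_le (by linarith [mem_Ioi.1 hs])) (mem_Ioi.2 hs)

theorem deriv_stepUp_eq_zero {s : ℝ} (hs : 1 < |s|) : deriv stepUp s = 0 := by
  rcases lt_abs.1 hs with h | h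
  · exact deriv_stepUp_eq_zero_of_gt (by linarith)
  · exact deriv_eq_zero_of_isOpen (c := 0) (A := Iio (-(3 / 4))) isOpen_Iio
      (fun s hs => Real.smoothTransition.zero_of_nonpos (by linarith [mem_Iio.1 hs]))
      (mem_Iio.2 (by linarith))

theorem plateau_eq_zero {s : ℝ} (hs : 1 < |s|) : plateau s = 0 := by
  rcases lt_abs.1 hs with h | h
  · rw [plateau, Real.smoothTransition.zero_of_nonpos (x := 3 - 4 * s) (by linarith), mul_zero]
  · rw [plateau, stepUp, Real.smoothTransition.zero_of_nonpos (x := 4 * s + 3) (by linarith),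
      zero_mul]

theorem deriv_plateau_eventuallyEq {s : ℝ} (hs : s < 1 / 2) :
    deriv plateau =ᶠ[𝓝 s] deriv stepUp := by
  have h : plateau =ᶠ[𝓝 s] stepUp := by
    filter_upwards [Iio_mem_nhds hs] with x hx
    rw [plateau, Real.smoothTransition.one_of_one_le (by linarith [mem_Iio.1 hx]), mul_one]
  exact h.deriv

theorem deriv_stepUp_nonneg (s : ℝ) : 0 ≤ deriv stepUp s := by
  refine Monotone.deriv_nonneg fun a b hab => ?_
  exact Real.smoothTransition.monotone (by linarith)

theorem exists_deriv_stepUp_ne_zero : ∃ s, deriv stepUp s ≠ 0 := by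
  obtain ⟨s, -, hs⟩ := exists_deriv_eq_slope stepUp (show (-1 : ℝ) < 0 by norm_num)
    contDiff_stepUp.continuous.continuousOn (contDiff_stepUp.differentiable (by simp)).differentiableOn
  refine ⟨s, ?_⟩
  have h0 : stepUp (-1) = 0 := Real.smoothTransition.zero_of_nonpos (by norm_num)
  have h1 : stepUp 0 = 1 := Real.smoothTransition.one_of_one_le (by norm_num)
  rw [hs, h0, h1]; norm_num

theorem unitBump_eq_zero {E : Type*} [NormedAddCommGroup E] [NormedSpace ℝ E]
    [HasContDiffBump E] {x : E} (hx : 1 < ‖x‖) : unitBump E x = 0 :=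
  (unitBump E).zero_of_le_dist (by simpa [unitBump] using hx.le)

theorem unitBump_zero {E : Type*} [NormedAddCommGroup E] [NormedSpace ℝ E]
    [HasContDiffBump E] : unitBump E 0 = 1 :=
  (unitBump E).one_of_mem_closedBall (by simp [unitBump])

variable {N : ℕ}

/-- The linear form `(σ, y) ↦ y · ν - w σ`, whose kernel is the hyperplane with normal `ν` moving
with speed `w`. -/
noncomputable def frontForm (ν : Space N) (w : ℝ) : ℝ × Space N →L[ℝ] ℝ :=
  (innerSL ℝ ν).comp (ContinuousLinearMap.snd ℝ ℝ (Space N)) -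
    w • ContinuousLinearMap.fst ℝ ℝ (Space N)

theorem frontForm_apply (ν : Space N) (w : ℝ) (ζ : ℝ × Space N) :
    frontForm ν w ζ = ⟪ζ.2, ν⟫ - ζ.1 * w := by
  simp [frontForm, real_inner_comm, mul_comm]

/-- A product of a function of time, a cutoff in the directions tangential to the moving
hyperplane, and a function of the signed distance to it. -/
noncomputable def profile (ν : Space N) (w : ℝ) (β η : ℝ → ℝ) (ζ : ℝ × Space N) : ℝ :=
  β ζ.1 * unitBump (Space N) (ζ.2 - ⟪ζ.2, ν⟫ • ν) * η (frontForm ν w ζ)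

variable {ν : Space N} {w : ℝ} {β η : ℝ → ℝ}

theorem contDiff_profile (hβ : ContDiff ℝ ∞ β) (hη : ContDiff ℝ ∞ η) :
    ContDiff ℝ ∞ (profile ν w β η) := by
  have h1 : ContDiff ℝ ∞ fun ζ : ℝ × Space N => ζ.2 - ⟪ζ.2, ν⟫ • ν :=
    contDiff_snd.sub ((contDiff_snd.inner ℝ contDiff_const).smul contDiff_const)
  exact ((hβ.comp contDiff_fst).mul ((unitBump (Space N)).contDiff.comp h1)).mul
    (hη.comp (frontForm ν w).contDiff)

theorem norm_le_of_profile_ne_zero (hν : ‖ν‖ = 1) (hw : |w| ≤ 1)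
    (hβ : ∀ s, 1 < |s| → β s = 0) (hη : ∀ s, 1 < |s| → η s = 0) {ζ : ℝ × Space N}
    (h : profile ν w β η ζ ≠ 0) : ‖ζ‖ ≤ 3 := by
  have h1 : |ζ.1| ≤ 1 := by
    by_contra! hc; exact h (by rw [profile, hβ _ hc]; simp)
  have h2 : ‖ζ.2 - ⟪ζ.2, ν⟫ • ν‖ ≤ 1 := by
    by_contra! hc; exact h (by rw [profile, unitBump_eq_zero hc]; simp)
  have h3 : |frontForm ν w ζ| ≤ 1 := by
    by_contra! hc; exact h (by rw [profile, hη _ hc]; simp)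
  rw [frontForm_apply] at h3
  have h4 : |⟪ζ.2, ν⟫| ≤ 2 := by
    have h5 : |ζ.1 * w| ≤ 1 := by rw [abs_mul]; exact mul_le_one₀ h1 (abs_nonneg _) hw
    rw [abs_le] at *
    constructor <;> linarith [h3.1, h3.2, h5.1, h5.2]
  have h6 : ‖ζ.2‖ ≤ 3 := by
    have h7 : ζ.2 = (ζ.2 - ⟪ζ.2, ν⟫ • ν) + ⟪ζ.2, ν⟫ • ν := by abel
    have h8 : ‖⟪ζ.2, ν⟫ • ν‖ ≤ 2 := by rw [norm_smul, hν, mul_one]; exact h4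
    rw [h7]
    exact (norm_add_le _ _).trans (by linarith)
  rw [Prod.norm_def]
  exact max_le (by rw [Real.norm_eq_abs]; linarith) h6

theorem hasCompactSupport_profile (hν : ‖ν‖ = 1) (hw : |w| ≤ 1)
    (hβ : ∀ s, 1 < |s| → β s = 0) (hη : ∀ s, 1 < |s| → η s = 0) :
    HasCompactSupport (profile ν w β η) := by
  refine HasCompactSupport.intro (isCompact_closedBall 0 3) fun ζ hζ => ?_
  by_contra h
  exact hζ (mem_closedBall_zero_iff.2 (norm_le_of_profile_ne_zero hν hw hβ hη h))

theorem hasLineDerivAt_profile_normal (hν : ‖ν‖ = 1) (hη : ContDiff ℝ ∞ η)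
    (ζ : ℝ × Space N) :
    HasLineDerivAt ℝ (profile ν w β η) (profile ν w β (deriv η) ζ) ζ (0, ν) := by
  have hνν : ⟪ν, ν⟫ = (1 : ℝ) := by rw [real_inner_self_eq_norm_sq, hν]; norm_num
  have heq : (fun h : ℝ => profile ν w β η (ζ + h • (0, ν))) = fun h =>
      β ζ.1 * unitBump (Space N) (ζ.2 - ⟪ζ.2, ν⟫ • ν) * η (frontForm ν w ζ + h) := by
    funext h
    have h1 : (ζ + h • ((0 : ℝ), ν)).2 - ⟪(ζ + h • ((0 : ℝ), ν)).2, ν⟫ • ν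
        = ζ.2 - ⟪ζ.2, ν⟫ • ν := by
      simp only [Prod.snd_add, Prod.smul_snd, inner_add_left, real_inner_smul_left, hνν]
      module
    have h2 : frontForm ν w (ζ + h • (0, ν)) = frontForm ν w ζ + h := by
      rw [map_add, map_smul, frontForm_apply ν w (0, ν)]; simp [hν]
    rw [profile, h1, h2]; simp
  rw [HasLineDerivAt, heq, profile]
  refine HasDerivAt.const_mul _ ?_
  have h3 := (hη.differentiable (by simp) (frontForm ν w ζ + 0)).hasDerivAt.comp_const_add
    (frontForm ν w ζ) 0
  simpa using h3

theorem hasLineDerivAt_profile_time (hβ : ContDiff ℝ ∞ β) (hη : ContDiff ℝ ∞ η)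
    (ζ : ℝ × Space N) :
    HasLineDerivAt ℝ (profile ν w β η)
      (profile ν w (deriv β) η ζ - w * profile ν w β (deriv η) ζ) ζ (1, 0) := by
  have heq : (fun h : ℝ => profile ν w β η (ζ + h • (1, 0))) = fun h =>
      β (ζ.1 + h) * unitBump (Space N) (ζ.2 - ⟪ζ.2, ν⟫ • ν) * η (frontForm ν w ζ - h * w) := by
    funext h
    have h2 : frontForm ν w (ζ + h • (1, 0)) = frontForm ν w ζ - h * w := by
      rw [map_add, map_smul, frontForm_apply ν w (1, 0)]; simp [sub_eq_add_neg]
    rw [profile, h2]; simp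
  rw [HasLineDerivAt, heq]
  have h1 : HasDerivAt (fun h : ℝ => β (ζ.1 + h)) (deriv β ζ.1) 0 := by
    simpa using (hβ.differentiable (by simp) (ζ.1 + 0)).hasDerivAt.comp_const_add ζ.1 0
  have h2 : HasDerivAt (fun h : ℝ => frontForm ν w ζ - h * w) (-w) 0 := by
    simpa using ((hasDerivAt_id (0 : ℝ)).mul_const w).const_sub (frontForm ν w ζ)
  have h3 : HasDerivAt (fun h : ℝ => η (frontForm ν w ζ - h * w))
      (deriv η (frontForm ν w ζ) * -w) 0 := by
    have := (hη.differentiable (by simp) (frontForm ν w ζ - 0 * w)).hasDerivAt.comp (0 : ℝ) h2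
    simpa [Function.comp_def] using this
  refine ((h1.mul_const (unitBump (Space N) (ζ.2 - ⟪ζ.2, ν⟫ • ν))).fun_mul h3).congr_deriv ?_
  simp only [profile, add_zero, zero_mul, sub_zero]
  ring

theorem fderiv_eq_of_hasLineDerivAt {W : Type*} [NormedAddCommGroup W] [NormedSpace ℝ W]
    {φ : W → ℝ} {x v : W} {d : ℝ} (hφ : DifferentiableAt ℝ φ x) (h : HasLineDerivAt ℝ φ d x v) :
    fderiv ℝ φ x v = d := by
  rw [← hφ.lineDeriv_eq_fderiv, h.lineDeriv]

theorem fderiv_comp_blowup {W : Type*} [NormedAddCommGroup W] [NormedSpace ℝ W]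
    {φ : W → ℝ} (hφ : Differentiable ℝ φ) (z x v : W) (c : ℝ) :
    fderiv ℝ (fun x => φ (c • (x - z))) x v = c * fderiv ℝ φ (c • (x - z)) v := by
  have h1 : HasFDerivAt (fun x => c • (x - z)) (c • ContinuousLinearMap.id ℝ W) x :=
    ((hasFDerivAt_id x).sub_const z).const_smul c
  have h2 := (hφ (c • (x - z))).hasFDerivAt.comp x h1
  rw [show (fun x => φ (c • (x - z))) = φ ∘ fun x => c • (x - z) from rfl, h2.fderiv]
  simp

/-- In the frame moving with the hyperplane the half space does not depend on time, so the time
derivative of the first factor integrates to zero over it. -/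
theorem setIntegral_profile_deriv (hν : ‖ν‖ = 1) (hw : |w| ≤ 1) (hβ : ContDiff ℝ ∞ β)
    (hη : ContDiff ℝ ∞ η) (hβ0 : ∀ s, 1 < |s| → β s = 0) (hη0 : ∀ s, 1 < |s| → η s = 0) :
    ∫ ζ in {ζ | frontForm ν w ζ < 0}, profile ν w (deriv β) η ζ = 0 := by
  have hνν : ⟪ν, ν⟫ = (1 : ℝ) := by rw [real_inner_self_eq_norm_sq, hν]; norm_num
  have hH : IsOpen {ζ | frontForm ν w ζ < 0} := isOpen_lt (by fun_prop) continuous_const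
  have hint : Integrable (profile ν w (deriv β) η) :=
    (contDiff_profile hβ.deriv_top hη).continuous.integrable_of_hasCompactSupport
      (hasCompactSupport_profile hν hw (deriv_eq_zero_of_one_lt_abs hβ0) hη0)
  set k : Space N → ℝ := fun y => unitBump (Space N) (y - ⟪y, ν⟫ • ν) *
    (Iio (0 : ℝ)).indicator η ⟪y, ν⟫ with hk
  have hshear : ∀ (σ : ℝ) (y : Space N),
      ({ζ | frontForm ν w ζ < 0}.indicator (profile ν w (deriv β) η) (σ, y)) =
        deriv β σ * k (y - (σ * w) • ν) := by
    intro σ y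
    have h1 : ⟪y - (σ * w) • ν, ν⟫ = frontForm ν w (σ, y) := by
      rw [frontForm_apply, inner_sub_left, real_inner_smul_left, hνν, mul_one]
    have h2 : y - (σ * w) • ν - ⟪y - (σ * w) • ν, ν⟫ • ν = y - ⟪y, ν⟫ • ν := by
      rw [h1, frontForm_apply]; module
    simp only [hk]
    rw [h2, h1]
    by_cases h : frontForm ν w (σ, y) < 0
    · rw [indicator_of_mem (show (σ, y) ∈ {ζ | frontForm ν w ζ < 0} from h),
        indicator_of_mem (mem_Iio.2 h), profile]
      ring
    · rw [indicator_of_notMem (show (σ, y) ∉ {ζ | frontForm ν w ζ < 0} from h),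
        indicator_of_notMem (fun h' => h (mem_Iio.1 h'))]
      simp
  have hder : ∫ σ, deriv β σ = 0 := by
    have hc : HasCompactSupport β := HasCompactSupport.intro (isCompact_closedBall 0 1)
      fun s hs => hβ0 s (by simpa using hs)
    exact integral_eq_zero_of_hasDerivAt_of_integrable
      (fun s => (hβ.differentiable (by simp) s).hasDerivAt)
      (hβ.deriv_top.continuous.integrable_of_hasCompactSupport hc.deriv)
      (hβ.continuous.integrable_of_hasCompactSupport hc)
  rw [← integral_indicator hH.measurableSet, Measure.volume_eq_prod, integral_prod]
  · simp_rw [hshear, integral_const_mul]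
    have h3 : ∀ σ : ℝ, ∫ y, k (y - (σ * w) • ν) = ∫ y, k y := fun σ =>
      integral_sub_right_eq_self k ((σ * w) • ν)
    simp_rw [h3]
    rw [integral_mul_const, hder, zero_mul]
  · rw [← Measure.volume_eq_prod]
    exact hint.indicator hH.measurableSet

end Profile

/-! ### The boundary relation between the time derivative and the normal derivative -/

section Relation

variable {N : ℕ}

theorem isAddHaarMeasure_volume_prod :
    (volume : Measure (ℝ × Space N)).IsAddHaarMeasure := by
  rw [Measure.volume_eq_prod]; infer_instance

/-- The cone condition determines the blow-up of the set: it is the half space, up to the null set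
of the bounding hyperplane. -/
theorem ae_eventually_mem_iff {O : Set (ℝ × Space N)} {ν : Space N} (hν : ‖ν‖ = 1) {w : ℝ}
    {z₀ : ℝ × Space N} (hcone : ∀ ε > 0, ∀ᶠ z in 𝓝 z₀,
      (frontForm ν w (z - z₀) < -(ε * ‖z - z₀‖) → z ∈ O) ∧
      (ε * ‖z - z₀‖ < frontForm ν w (z - z₀) → z ∉ O)) :
    ∀ᵐ ζ, ∀ᶠ r in 𝓝[>] (0 : ℝ), (z₀ + r • ζ ∈ O ↔ ζ ∈ {ζ | frontForm ν w ζ < 0}) := by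
  have := isAddHaarMeasure_volume_prod (N := N)
  have hker : volume ((frontForm ν w).ker : Set (ℝ × Space N)) = 0 := by
    refine Measure.addHaar_submodule _ _ fun h => ?_
    have h1 : ((0 : ℝ), ν) ∈ (frontForm ν w).ker := by rw [h]; trivial
    have h2 : frontForm ν w (0, ν) = 0 := h1
    rw [frontForm_apply] at h2
    simp [hν] at h2
  have hker' : ∀ᵐ ζ : ℝ × Space N, ζ ∉ ((frontForm ν w).ker : Set (ℝ × Space N)) :=
    measure_eq_zero_iff_ae_notMem.1 hker
  filter_upwards [hker'] with ζ hζ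
  replace hζ : frontForm ν w ζ ≠ 0 := hζ
  have hε : 0 < |frontForm ν w ζ| / (‖ζ‖ + 1) := by
    have := abs_pos.2 hζ; positivity
  have hlim : Tendsto (fun r : ℝ => z₀ + r • ζ) (𝓝[>] 0) (𝓝 z₀) := by
    have h1 : Tendsto (fun r : ℝ => z₀ + r • ζ) (𝓝 0) (𝓝 (z₀ + (0 : ℝ) • ζ)) :=
      (by fun_prop : Continuous fun r : ℝ => z₀ + r • ζ).tendsto 0
    rw [zero_smul, add_zero] at h1
    exact h1.mono_left nhdsWithin_le_nhds
  filter_upwards [hlim.eventually (hcone _ hε), self_mem_nhdsWithin] with r hr hr0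
  replace hr0 : 0 < r := hr0
  rw [add_sub_cancel_left, map_smul, norm_smul, Real.norm_eq_abs, abs_of_pos hr0,
    smul_eq_mul] at hr
  have hlt : |frontForm ν w ζ| / (‖ζ‖ + 1) * (r * ‖ζ‖) < r * |frontForm ν w ζ| := by
    rw [div_mul_eq_mul_div, div_lt_iff₀ (by positivity)]
    have := mul_pos hr0 (abs_pos.2 hζ)
    nlinarith
  rcases lt_or_gt_of_ne hζ with h | h
  · rw [abs_of_neg h] at hr hlt
    exact iff_of_true (hr.1 (by linarith)) h
  · rw [abs_of_pos h] at hr hlt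
    exact iff_of_false (hr.2 (by linarith)) (not_lt.2 h.le)

/-- Let `O` have, at `z₀`, the tangent half space `y · ν < w σ`, and let `u` be integrated by parts
in the direction `ν` without boundary terms. Then the traces `a` of `∂_t u` and `b` of `∂_ν u` at
`z₀` satisfy `a + w b = 0`.

With `Θ = ∂_t (profile β plateau)`, where `β` is a bump in time, one has `∂_ν Θ = ∂_t ψ` on the
rescaled domain for `ψ = profile β stepUp'`, which is supported inside it. Hence
`∫ ∂_ν u Θ = ∫ ∂_t u ψ` at all small scales, and in the blow-up limit this becomes
`b ∫_H Θ = a ∫_H ψ`, where `∫_H Θ = -w ∫_H ψ` and `∫_H ψ > 0`. -/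
theorem trace_add_mul_trace_eq_zero {O : Set (ℝ × Space N)} (hO : IsOpen O) {ν : Space N}
    (hν : ‖ν‖ = 1) {w : ℝ} (hw : |w| ≤ 1) {z₀ : ℝ × Space N}
    (hcone : ∀ ε > 0, ∀ᶠ z in 𝓝 z₀,
      (frontForm ν w (z - z₀) < -(ε * ‖z - z₀‖) → z ∈ O) ∧
      (ε * ‖z - z₀‖ < frontForm ν w (z - z₀) → z ∉ O))
    {u ut uν : ℝ × Space N → ℝ} (hut : MemL2 O ut) (huν : MemL2 O uν)
    (htime : IsWeakDeriv O (1, 0) u ut)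
    (hspace : ∀ Θ : ℝ × Space N → ℝ, ContDiff ℝ ∞ Θ → HasCompactSupport Θ →
      ∫ z in O, u z * fderiv ℝ Θ z (0, ν) = -∫ z in O, uν z * Θ z)
    {a b : ℝ} (ha : HasTraceAt O ut z₀ a) (hb : HasTraceAt O uν z₀ b) : a + w * b = 0 := by
  have := isAddHaarMeasure_volume_prod (N := N)
  set β : ℝ → ℝ := fun s => unitBump ℝ s with hβdef
  have hβ : ContDiff ℝ ∞ β := (unitBump ℝ).contDiff
  have hβ0 : ∀ s, 1 < |s| → β s = 0 := fun s hs => unitBump_eq_zero hs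
  have hβ0' := deriv_eq_zero_of_one_lt_abs hβ0
  have hS := contDiff_plateau
  have hS0 : ∀ s, 1 < |s| → plateau s = 0 := fun s hs => plateau_eq_zero hs
  have hS0' := deriv_eq_zero_of_one_lt_abs hS0
  have hS0'' := deriv_eq_zero_of_one_lt_abs hS0'
  have hk : ContDiff ℝ ∞ (deriv stepUp) := contDiff_stepUp.deriv_top
  have hk0 : ∀ s, 1 < |s| → deriv stepUp s = 0 := fun s hs => deriv_stepUp_eq_zero hs
  have hk0' := deriv_eq_zero_of_one_lt_abs hk0
  set ψ := profile ν w β (deriv stepUp) with hψdef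
  set Θ₁ := profile ν w (deriv β) plateau with hΘ₁
  set Θ₂ := profile ν w β (deriv plateau) with hΘ₂
  set Θ : ℝ × Space N → ℝ := fun ζ => Θ₁ ζ - w * Θ₂ ζ with hΘdef
  have hψ : ContDiff ℝ ∞ ψ := contDiff_profile hβ hk
  have hψc : HasCompactSupport ψ := hasCompactSupport_profile hν hw hβ0 hk0
  have hΘ₁s : ContDiff ℝ ∞ Θ₁ := contDiff_profile hβ.deriv_top hS
  have hΘ₂s : ContDiff ℝ ∞ Θ₂ := contDiff_profile hβ hS.deriv_top
  have hΘ₁c : HasCompactSupport Θ₁ := hasCompactSupport_profile hν hw hβ0' hS0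
  have hΘ₂c : HasCompactSupport Θ₂ := hasCompactSupport_profile hν hw hβ0 hS0'
  have hΘ : ContDiff ℝ ∞ Θ := hΘ₁s.sub (contDiff_const.mul hΘ₂s)
  have hΘc : HasCompactSupport Θ := hΘ₁c.sub (hΘ₂c.mul_left (f := fun _ => w))
  -- The integrals over the half space.
  have hH := ae_eventually_mem_iff hν hcone
  set H := {ζ : ℝ × Space N | frontForm ν w ζ < 0} with hHdef
  have hHo : IsOpen H := isOpen_lt (by fun_prop) continuous_const
  have hψH : ∫ ζ in H, ψ ζ = ∫ ζ, ψ ζ := by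
    refine setIntegral_eq_integral_of_forall_compl_eq_zero fun ζ hζ => ?_
    rw [hψdef, profile, deriv_stepUp_eq_zero_of_gt, mul_zero]
    linarith [not_lt.1 (show ¬ frontForm ν w ζ < 0 from hζ)]
  have hpos : 0 < ∫ ζ in H, ψ ζ := by
    rw [hψH]
    obtain ⟨s, hs⟩ := exists_deriv_stepUp_ne_zero
    refine hψ.continuous.integral_pos_of_hasCompactSupport_nonneg_nonzero
      (x := ((0 : ℝ), s • ν)) hψc (fun ζ => ?_) ?_
    · exact mul_nonneg (mul_nonneg (unitBump ℝ).nonneg (unitBump _).nonneg)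
        (deriv_stepUp_nonneg _)
    · have h1 : ⟪s • ν, ν⟫ = s := by
        rw [real_inner_smul_left, real_inner_self_eq_norm_sq, hν]; ring
      have h2 : frontForm ν w (0, s • ν) = s := by rw [frontForm_apply, h1]; ring
      rw [hψdef, profile, h2, hβdef]
      simp only [h1, sub_self]
      rw [unitBump_zero, unitBump_zero]
      simpa using hs
  have hΘH : ∫ ζ in H, Θ ζ = -w * ∫ ζ in H, ψ ζ := by
    have hi1 : Integrable Θ₁ (volume.restrict H) :=
      (hΘ₁s.continuous.integrable_of_hasCompactSupport hΘ₁c).restrict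
    have hi2 : Integrable Θ₂ (volume.restrict H) :=
      (hΘ₂s.continuous.integrable_of_hasCompactSupport hΘ₂c).restrict
    have h2 : ∫ ζ in H, Θ₂ ζ = ∫ ζ in H, ψ ζ := by
      refine setIntegral_congr_fun hHo.measurableSet fun ζ hζ => ?_
      have hlt : frontForm ν w ζ < 1 / 2 := lt_trans hζ (by norm_num)
      rw [hΘ₂, hψdef, profile, profile, (deriv_plateau_eventuallyEq hlt).eq_of_nhds]
    rw [hΘdef, integral_sub hi1 (hi2.const_mul w), integral_const_mul, h2,
      setIntegral_profile_deriv hν hw hβ hS hβ0 hS0]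
    ring
  -- The cone condition at scale `r`, on the support of the test functions.
  obtain ⟨ρ, hρ, hball⟩ := Metric.eventually_nhds_iff_ball.1 (hcone (1 / 8) (by norm_num))
  have hscale : ∀ r : ℝ, 0 < r → 3 * r < ρ → ∀ x, ‖r⁻¹ • (x - z₀)‖ ≤ 3 →
      (frontForm ν w (r⁻¹ • (x - z₀)) ≤ -(1 / 2) → x ∈ O) ∧
      (1 / 2 ≤ frontForm ν w (r⁻¹ • (x - z₀)) → x ∉ O) := by
    intro r hr hrρ x hx
    rw [norm_smul, norm_inv, Real.norm_eq_abs, abs_of_pos hr, inv_mul_le_iff₀ hr] at hx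
    obtain ⟨h1, h2⟩ := hball x (by rw [Metric.mem_ball, dist_eq_norm]; linarith)
    rw [map_smul, smul_eq_mul]
    constructor
    · intro h
      rw [inv_mul_le_iff₀ hr] at h
      exact h1 (by linarith)
    · intro h
      rw [le_inv_mul_iff₀ hr] at h
      exact h2 (by linarith)
  -- The identity between the two integrals at scale `r`.
  have hident : ∀ r : ℝ, 0 < r → 3 * r < ρ →
      ∫ x in O, uν x * Θ (r⁻¹ • (x - z₀)) = ∫ x in O, ut x * ψ (r⁻¹ • (x - z₀)) := by
    intro r hr hrρ
    have haff : ContDiff ℝ ∞ fun x : ℝ × Space N => r⁻¹ • (x - z₀) := by fun_prop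
    have hcomp : ∀ {φ : ℝ × Space N → ℝ}, HasCompactSupport φ →
        HasCompactSupport fun x => φ (r⁻¹ • (x - z₀)) := fun hφ => by
      simpa [Function.comp_def, sub_eq_add_neg] using hφ.comp_homeomorph
        ((Homeomorph.addRight (-z₀)).trans (Homeomorph.smulOfNeZero r⁻¹ (inv_ne_zero hr.ne')))
    have hψO : (fun x => ψ (r⁻¹ • (x - z₀))) ∈ testSpace O := by
      refine ⟨hψ.comp haff, hcomp hψc, ?_⟩
      have hcl : IsClosed {x : ℝ × Space N | ‖r⁻¹ • (x - z₀)‖ ≤ 3 ∧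
          frontForm ν w (r⁻¹ • (x - z₀)) ≤ -(1 / 2)} :=
        IsClosed.and (isClosed_le (by fun_prop) continuous_const)
          (isClosed_le (by fun_prop) continuous_const)
      refine (closure_minimal (fun x hx => ?_) hcl).trans
        fun x hx => (hscale r hr hrρ x hx.1).1 hx.2
      rw [Function.mem_support] at hx
      refine ⟨norm_le_of_profile_ne_zero hν hw hβ0 hk0 hx, ?_⟩
      by_contra! h
      exact hx (by rw [hψdef, profile, deriv_stepUp_eq_zero_of_gt h, mul_zero])
    have hderiv : ∀ x ∈ O, fderiv ℝ (fun x => Θ (r⁻¹ • (x - z₀))) x (0, ν) =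
        fderiv ℝ (fun x => ψ (r⁻¹ • (x - z₀))) x (1, 0) := by
      intro x hx
      rw [fderiv_comp_blowup (hΘ.differentiable (by simp)),
        fderiv_comp_blowup (hψ.differentiable (by simp))]
      congr 1
      set ζ := r⁻¹ • (x - z₀) with hζ
      have hΘν : HasLineDerivAt ℝ Θ (profile ν w (deriv β) (deriv plateau) ζ -
          w * profile ν w β (deriv (deriv plateau)) ζ) ζ (0, ν) :=
        HasDerivAt.sub (hasLineDerivAt_profile_normal hν hS ζ)
          ((hasLineDerivAt_profile_normal hν hS.deriv_top ζ).const_mul w)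
      rw [fderiv_eq_of_hasLineDerivAt (hΘ.differentiable (by simp) ζ) hΘν,
        fderiv_eq_of_hasLineDerivAt (hψ.differentiable (by simp) ζ)
          (hasLineDerivAt_profile_time hβ hk ζ)]
      by_cases hlt : frontForm ν w ζ < 1 / 2
      · have h1 := deriv_plateau_eventuallyEq hlt
        simp only [profile, h1.eq_of_nhds, h1.deriv_eq]
      · -- Outside `{frontForm < 1/2}` the domain does not meet the supports.
        have hzero : ∀ {β η : ℝ → ℝ}, (∀ s, 1 < |s| → β s = 0) → (∀ s, 1 < |s| → η s = 0) →
            profile ν w β η ζ = 0 := fun h1 h2 => by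
          by_contra h
          exact (hscale r hr hrρ x (norm_le_of_profile_ne_zero hν hw h1 h2 h)).2
            (not_lt.1 hlt) hx
        rw [hzero hβ0' hS0', hzero hβ0 hS0'', hzero hβ0' hk0, hzero hβ0 hk0']
    have h1 := hspace _ (hΘ.comp haff) (hcomp hΘc)
    have h2 := htime _ hψO
    have h3 : ∫ x in O, u x * fderiv ℝ (fun x => Θ (r⁻¹ • (x - z₀))) x (0, ν) =
        ∫ x in O, u x * fderiv ℝ (fun x => ψ (r⁻¹ • (x - z₀))) x (1, 0) :=
      setIntegral_congr_fun hO.measurableSet fun x hx => by simp only [hderiv x hx]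
    simp only [Function.comp_def] at h1
    linarith
  have hlimψ := ha.tendsto_blowup hO.measurableSet hHo.measurableSet hut hH hψ.continuous hψc
  have hlimΘ := hb.tendsto_blowup hO.measurableSet hHo.measurableSet huν hH hΘ.continuous hΘc
  have heq : a * ∫ ζ in H, ψ ζ = b * ∫ ζ in H, Θ ζ := by
    refine tendsto_nhds_unique hlimψ (hlimΘ.congr' ?_)
    filter_upwards [self_mem_nhdsWithin,
      nhdsWithin_le_nhds (Iio_mem_nhds (show (0 : ℝ) < ρ / 3 by positivity))] with r hr hrρ
    rw [hident r hr (by linarith [mem_Iio.1 hrρ])]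
  rw [hΘH] at heq
  have : (a + w * b) * ∫ ζ in H, ψ ζ = 0 := by linear_combination heq
  exact (mul_eq_zero.1 this).resolve_right hpos.ne'

end Relation

section Wave

variable {N : ℕ} {T : ℝ} {Ω : ℝ → Set (Space N)} {Φ Ψ : ℝ × Space N → Space N}

/-- The relation `∂_t u + ω ∂_ν u = 0` on the lateral boundary, at a point where the outer normal
exists: `u` vanishes on the lateral boundary, and the space-time vector `(1, ω ν)` is tangential to
it. At the points without a trace both terms are `0` by the convention of `traceAt`. -/
theorem boundaryVelocity_eq (hopen : ∀ t ∈ Icc 0 T, IsOpen (Ω t))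
    (hmono : ∀ s t, 0 ≤ s → s ≤ t → t ≤ T → Ω s ⊆ Ω t) (h : IsMovingDiffeo T Ω Φ Ψ)
    {u ut : ℝ × Space N → ℝ} {gu : ℝ × Space N → Space N} (hu : MemEnergySpace T Ω u ut gu)
    {t : ℝ} (ht : t ∈ Ioo 0 T) {x : Space N} (hx : x ∈ frontier (Ω t))
    (hν : IsOuterNormal (Ω t) x (outerNormal (Ω t) x)) :
    boundaryVelocity T Ω ut gu t x =
      -(normalVelocity T Ω Φ Ψ t x * normalDeriv T Ω ut gu t x) := by
  by_cases hex : ∃ a, HasTraceAt (spaceTime T Ω) (fun z => (ut z, gu z)) (t, x) a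
  · have htr : HasTraceAt (spaceTime T Ω) (fun z => (ut z, gu z)) (t, x)
        (gradTrace T Ω ut gu t x) := by
      rw [gradTrace, traceAt, dif_pos hex]; exact hex.choose_spec
    have hO := h.isOpen_spaceTime hopen
    have hg : MemL2 (spaceTime T Ω) (fun z => ⟪gu z, outerNormal (Ω t) x⟫) :=
      hu.memL2_grad.inner_const _
    have hω : |normalVelocity T Ω Φ Ψ t x| ≤ 1 :=
      abs_le.2 ⟨(by norm_num : (-1 : ℝ) ≤ 0).trans (h.normalVelocity_nonneg hmono ht hx hν),
        (h.normalVelocity_lt_one ht hx hν).le⟩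
    have ha : HasTraceAt (spaceTime T Ω) ut (t, x) (gradTrace T Ω ut gu t x).1 :=
      htr.clm_apply (ContinuousLinearMap.fst ℝ ℝ (Space N))
    have hb : HasTraceAt (spaceTime T Ω) (fun z => ⟪gu z, outerNormal (Ω t) x⟫) (t, x)
        ⟪(gradTrace T Ω ut gu t x).2, outerNormal (Ω t) x⟫ :=
      htr.clm_apply ((innerSLFlip ℝ (outerNormal (Ω t) x)).comp
        (ContinuousLinearMap.snd ℝ ℝ (Space N)))
    have hcone : ∀ ε > 0, ∀ᶠ z in 𝓝 (t, x),
        (frontForm (outerNormal (Ω t) x) (normalVelocity T Ω Φ Ψ t x) (z - (t, x)) <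
          -(ε * ‖z - (t, x)‖) → z ∈ spaceTime T Ω) ∧
        (ε * ‖z - (t, x)‖ <
          frontForm (outerNormal (Ω t) x) (normalVelocity T Ω Φ Ψ t x) (z - (t, x)) →
            z ∉ spaceTime T Ω) := fun ε hε => by
      filter_upwards [h.spaceTime_normal hopen ht hx hν hε] with z hz
      rw [frontForm_apply]
      exact hz
    have := trace_add_mul_trace_eq_zero hO hν.1 hω hcone hu.memL2_time hg hu.weakDeriv_time
      (fun Θ hΘ hΘc => hu.integral_mul_fderiv (fun t ht => hopen t (Ioo_subset_Icc_self ht)) hO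
        hmono _ hΘ hΘc) ha hb
    rw [boundaryVelocity, normalDeriv]
    linarith
  · have h0 : gradTrace T Ω ut gu t x = 0 := by rw [gradTrace, traceAt, dif_neg hex]
    simp [boundaryVelocity, normalDeriv, h0]

/-- At almost every boundary point the outer normal exists, hence the domain moves outwards with
speed less than `1` and `∂_t u = -ω ∂_ν u`. -/
theorem aeBoundary_relation (hopen : ∀ t ∈ Icc 0 T, IsOpen (Ω t))
    (hlip : ∀ t ∈ Icc 0 T, HasLipschitzBoundary (Ω t))
    (hmono : ∀ s t, 0 ≤ s → s ≤ t → t ≤ T → Ω s ⊆ Ω t) (h : IsMovingDiffeo T Ω Φ Ψ)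
    {u ut : ℝ × Space N → ℝ} {gu : ℝ × Space N → Space N} (hu : MemEnergySpace T Ω u ut gu) :
    AEBoundary T Ω fun t x => 0 ≤ normalVelocity T Ω Φ Ψ t x ∧ normalVelocity T Ω Φ Ψ t x < 1 ∧
      boundaryVelocity T Ω ut gu t x =
        -(normalVelocity T Ω Φ Ψ t x * normalDeriv T Ω ut gu t x) := by
  rw [AEBoundary, ← Measure.restrict_congr_set Ioo_ae_eq_Icc]
  filter_upwards [ae_restrict_mem measurableSet_Ioo] with t ht
  have ht' := Ioo_subset_Icc_self ht
  filter_upwards [(hlip t ht').ae_exists_isOuterNormal (hopen t ht'),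
    ae_restrict_mem isClosed_frontier.measurableSet] with x hex hx
  have hν : IsOuterNormal (Ω t) x (outerNormal (Ω t) x) := by
    rw [outerNormal, dif_pos hex]; exact hex.choose_spec
  exact ⟨h.normalVelocity_nonneg hmono ht hx hν, h.normalVelocity_lt_one ht hx hν,
    boundaryVelocity_eq hopen hmono h hu ht hx hν⟩

theorem AEBoundary.congr {P Q R : ℝ → Space N → Prop} (hR : AEBoundary T Ω R)
    (h : ∀ t x, R t x → (P t x ↔ Q t x)) : AEBoundary T Ω P ↔ AEBoundary T Ω Q := by
  refine eventually_congr ?_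
  filter_upwards [hR] with t ht
  refine eventually_congr ?_
  filter_upwards [ht] with x hx using h t x hx

end Wave

theorem mainTheorem7 {N : ℕ} (hN : 1 ≤ N) (T : ℝ) (hT : 0 < T)
    (Ω : ℝ → Set (Space N))
    (hΩ_nonempty : ∀ t ∈ Icc 0 T, (Ω t).Nonempty)
    (hΩ_open : ∀ t ∈ Icc 0 T, IsOpen (Ω t))
    (hΩ_bounded : ∀ t ∈ Icc 0 T, Bornology.IsBounded (Ω t))
    (hΩ_lipschitz : ∀ t ∈ Icc 0 T, HasLipschitzBoundary (Ω t))
    (hΩ_mono : ∀ s t, 0 ≤ s → s ≤ t → t ≤ T → Ω s ⊆ Ω t)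
    (hΩ₀ : Convex ℝ (Ω 0) ∨ HasC2Boundary (Ω 0))
    (Φ Ψ : ℝ × Space N → Space N) (hΦΨ : IsMovingDiffeo T Ω Φ Ψ)
    (f : ℝ × Space N → ℝ) (hf : MemH1 (spaceTime T Ω) f)
    (u₀ u₁ : Space N → ℝ) (hu₀ : MemH2 (Ω 0) u₀) (hu₀_zero : MemH10 (Ω 0) u₀)
    (g₀ : Space N → Space N) (hg₀_L2 : MemL2 (Ω 0) g₀)
    (hg₀ : ∀ v, IsWeakDeriv (Ω 0) v u₀ (fun y => ⟪g₀ y, v⟫))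
    (hu₁ : MemH10 (Ω 0) (fun y => u₁ y + ⟪timeDeriv T Φ 0 y, g₀ y⟫))
    (u ut : ℝ × Space N → ℝ) (gu : ℝ × Space N → Space N)
    (hu : IsWeakSolution T Ω f u₀ u₁ u ut gu)
    (κ : Space N → ℝ) (hκ_cont : Continuous κ) (hκ_pos : ∀ x, 0 < κ x) :
    [MaximumDissipation T Ω Φ Ψ ut gu κ,
      GriffithCriterion T Ω Φ Ψ ut gu κ,
      NormalDerivFormula T Ω Φ Ψ ut gu κ,
      CharacteristicFormula T Ω Φ Ψ ut gu κ].TFAE := by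
  have hrel := aeBoundary_relation hΩ_open hΩ_lipschitz hΩ_mono hΦΨ hu.energy
  have h12 : MaximumDissipation T Ω Φ Ψ ut gu κ ↔ GriffithCriterion T Ω Φ Ψ ut gu κ :=
    hrel.congr fun t x hx => by
      have := isGreatest_dissipation_iff (p := normalDeriv T Ω ut gu t x) (hκ_pos x) hx.1 hx.2.1
      simpa only [releaseRateDensity, hx.1, hx.2.1, true_and, and_self] using this
  have h32 : NormalDerivFormula T Ω Φ Ψ ut gu κ ↔ GriffithCriterion T Ω Φ Ψ ut gu κ :=
    hrel.congr fun t x hx => by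
      have := normalDeriv_formula_iff (p := normalDeriv T Ω ut gu t x) (hκ_pos x) hx.1
      simpa only [releaseRateDensity, hx.1, hx.2.1, true_and, and_self] using this
  have h42 : CharacteristicFormula T Ω Φ Ψ ut gu κ ↔ GriffithCriterion T Ω Φ Ψ ut gu κ :=
    hrel.congr fun t x hx => by
      have := characteristic_formula_iff (hκ_pos x) hx.1 hx.2.2
      simpa only [releaseRateDensity, hx.1, hx.2.1, true_and, and_self] using this
  tfae_have 1 ↔ 2 := h12
  tfae_have 3 ↔ 2 := h32
  tfae_have 4 ↔ 2 := h42
  tfae_finish
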